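/- Let $m=(m_0,m_1,\dots)$ be a bounded sequence of integers $m_k\ge 2$, let $G_m=\prod_{k}\mathbb{Z}/m_k\mathbb{Z}$ with its normalized Haar measure $\mu$ (the product of the uniform measures), and put $M_0=1$, $M_{k+1}=m_kM_k$. Every $n\in\mathbb{N}$ is uniquely $n=\sum_k n_kM_k$ with $0\le n_k<m_k$; let $\psi_n(x)=\prod_k \exp(2\pi i\,n_kx_k/m_k)$ be the Vilenkin functions. Let $\mathcal F_n$ be the $\sigma$-algebra generated by the sets $I_n(x)=\{y: y_0=x_0,\dots,y_{n-1}=x_{n-1}\}$. For $0<p<\infty$ the Hardy space $H_p$ consists of all complex martingales $f=(f^{(n)})_{n\in\mathbb{N}}$ with respect to $(\mathcal F_n)$ such that $\|f\|_{H_p}:=\|\sup_n|f^{(n)}|\|_p<\infty$, where $\|g\|_p=(\int|g|^p\,d\mu)^{1/p}$. For such $f$ put $\widehat f(i)=\lim_{k\to\infty}\int f^{(k)}\overline{\psi_i}\,d\mu$, $S_nf=\sum_{i=0}^{n-1}\widehat f(i)\psi_i$, $\sigma_nf=\frac1n\sum_{k=1}^nS_kf$, and $\omega(1/M_N,f)_{H_p}=\|f-S_{M_N}f\|_{H_p}$,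 where $f-S_{M_N}f$ is the martingale $(f^{(k)}-S_{M_N}f^{(k)})_k$, with $S_n$ of an integrable function being the $n$-th partial sum of its Vilenkin–Fourier series. Put $\|g\|_{L_{p,\infty}}=\sup_{\lambda>0}\lambda^p\mu(|g|>\lambda)$. In $\sigma_nf-f$ the martingale $f$ stands for its almost everywhere limit function $\lim_kf^{(k)}$. (a) For every $0<p<1/2$ there is a martingale $f\in H_p$, convergent almost everywhere, such that $\omega(1/M_N,f)_{H_p}=O\big(1/M_N^{1/p-2}\big)$ as $N\to\infty$, and $\|\sigma_nf-f\|_{L_{p,\infty}}\not\to0$ as $n\to\infty$. (b) There is a martingale $f\in H_{1/2}$, convergent almost everywhere, such that $\omega(1/M_N,f)_{H_{1/2}}=O(1/N^2)$ as $N\to\infty$, and $\|\sigma_nf-f\|_{1/2}\not\to0$ as $n\to\infty$. -/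

import Mathlib

open MeasureTheory Filter Topology
open scoped ENNReal ComplexConjugate

noncomputable section

namespace Vilenkin

/-- The Vilenkin group `G_m`, the complete direct product of the cyclic groups `ℤ / m_k ℤ`. -/
abbrev Group (m : ℕ → ℕ) : Type := ∀ k, ZMod (m k)

/-- The normalized Haar measure on `G_m`: the product of the uniform probability measures
on the cyclic factors. -/
def haar (m : ℕ → ℕ) [∀ k, NeZero (m k)] : Measure (Group m) :=
  Measure.infinitePi fun k => (PMF.uniformOfFintype (ZMod (m k))).toMeasure

instance instIsProbabilityMeasureHaar (m : ℕ → ℕ) [∀ k, NeZero (m k)] :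
    IsProbabilityMeasure (haar m) := by
  unfold haar; infer_instance

/-- The generalized powers `M_0 = 1`, `M_{k+1} = m_k M_k`. -/
def M (m : ℕ → ℕ) : ℕ → ℕ
  | 0 => 1
  | k + 1 => m k * M m k

/-- The `k`-th digit `n_k` of `n = ∑ n_j M_j`, `0 ≤ n_j < m_j`. -/
def digit (m : ℕ → ℕ) (n k : ℕ) : ℕ := n / M m k % m k

/-- The interval `I_n(x)`. -/
def interval (m : ℕ → ℕ) (n : ℕ) (x : Group m) : Set (Group m) :=
  {y | ∀ k < n, y k = x k}

/-- The generalized Rademacher function `r_k`. -/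
def rademacher (m : ℕ → ℕ) (k : ℕ) (x : Group m) : ℂ :=
  Complex.exp (2 * Real.pi * Complex.I * ((x k).val : ℂ) / (m k : ℂ))

/-- The Vilenkin function `ψ_n`; only finitely many factors differ from `1`. -/
def psi (m : ℕ → ℕ) (n : ℕ) (x : Group m) : ℂ :=
  ∏ᶠ k, rademacher m k x ^ digit m n k

theorem measurableSet_interval (m : ℕ → ℕ) (n : ℕ) (x : Group m) :
    MeasurableSet (interval m n x) := by
  have h : interval m n x = ⋂ k ∈ Finset.range n, (fun y : Group m => y k) ⁻¹' {x k} := by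
    ext y; simp [interval]
  rw [h]
  exact Finset.measurableSet_biInter _ fun k _ =>
    measurable_pi_apply k (MeasurableSet.singleton _)

/-- The σ-algebra `F_n` generated by the intervals `I_n(x)`, `x ∈ G_m`. -/
abbrev sigmaAlg (m : ℕ → ℕ) (n : ℕ) : MeasurableSpace (Group m) :=
  MeasurableSpace.generateFrom (Set.range (interval m n))

theorem sigmaAlg_le_succ (m : ℕ → ℕ) [∀ k, NeZero (m k)] (n : ℕ) :
    sigmaAlg m n ≤ sigmaAlg m (n + 1) := by
  refine MeasurableSpace.generateFrom_le ?_
  rintro _ ⟨x, rfl⟩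
  have h : interval m n x =
      ⋃ a : ZMod (m n), interval m (n + 1) (Function.update x n a) := by
    ext y
    simp only [interval, Set.mem_ofPred_eq, Set.mem_iUnion]
    constructor
    · intro hy
      refine ⟨y n, fun k hk => ?_⟩
      rcases Nat.lt_succ_iff_lt_or_eq.mp hk with hk | rfl
      · rw [Function.update_of_ne hk.ne]; exact hy k hk
      · simp
    · rintro ⟨a, ha⟩ k hk
      have := ha k (hk.trans (Nat.lt_succ_self n))
      rwa [Function.update_of_ne hk.ne] at this
  rw [h]
  exact @MeasurableSet.iUnion _ _ (sigmaAlg m (n + 1)) _ _ fun a =>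
    MeasurableSpace.measurableSet_generateFrom ⟨_, rfl⟩

/-- The filtration `(F_n)`. -/
def filtration (m : ℕ → ℕ) [∀ k, NeZero (m k)] :
    Filtration ℕ (inferInstance : MeasurableSpace (Group m)) where
  seq := sigmaAlg m
  mono' := monotone_nat_of_le_succ (sigmaAlg_le_succ m)
  le' n := by
    refine MeasurableSpace.generateFrom_le ?_
    rintro _ ⟨x, rfl⟩
    exact measurableSet_interval m n x

section

variable (m : ℕ → ℕ) [∀ k, NeZero (m k)]

/-- Vilenkin–Fourier coefficient of an integrable function. -/
def coeffFun (g : Group m → ℂ) (i : ℕ) : ℂ :=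
  ∫ x, g x * conj (psi m i x) ∂(haar m)

/-- Partial sum `S_n g` of the Vilenkin–Fourier series of an integrable function. -/
def partialSumFun (g : Group m → ℂ) (n : ℕ) (x : Group m) : ℂ :=
  ∑ i ∈ Finset.range n, coeffFun m g i * psi m i x

/-- Vilenkin–Fourier coefficient of a martingale: the limit of the coefficients of `f^(k)`
(for a martingale this sequence is eventually constant). -/
def coeff (f : ℕ → Group m → ℂ) (i : ℕ) : ℂ :=
  limUnder atTop fun k => coeffFun m (f k) i

/-- Partial sum `S_n f` of the Vilenkin–Fourier series of a martingale. -/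
def partialSum (f : ℕ → Group m → ℂ) (n : ℕ) (x : Group m) : ℂ :=
  ∑ i ∈ Finset.range n, coeff m f i * psi m i x

/-- Fejér mean `σ_n f = (1/n) ∑_{k=1}^n S_k f` of a martingale. -/
def fejer (f : ℕ → Group m → ℂ) (n : ℕ) (x : Group m) : ℂ :=
  (1 / (n : ℂ)) * ∑ k ∈ Finset.Icc 1 n, partialSum m f k x

/-- The `H_p` quasi-norm `‖f^*‖_p` with the maximal function `f^* = sup_n |f^(n)|`. -/
def hardyNorm (p : ℝ) (f : ℕ → Group m → ℂ) : ℝ≥0∞ :=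
  eLpNorm (fun x => ⨆ n, ‖f n x‖ₑ) (ENNReal.ofReal p) (haar m)

/-- `f` is a martingale with respect to `(F_n)` that belongs to `H_p`. -/
def MemHardy (p : ℝ) (f : ℕ → Group m → ℂ) : Prop :=
  Martingale f (filtration m) (haar m) ∧ hardyNorm m p f < ∞

/-- The modulus of continuity `ω(1/M_N, f)_{H_p} = ‖f - S_{M_N} f‖_{H_p}`, where
`f - S_{M_N} f` is the martingale `(f^(k) - S_{M_N} f^(k))_k`. -/
def modulus (p : ℝ) (f : ℕ → Group m → ℂ) (N : ℕ) : ℝ≥0∞ :=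
  hardyNorm m p fun k x => f k x - partialSumFun m (f k) (M m N) x

/-- The weak quasi-norm `sup_{t > 0} t^p μ(|g| > t)` of `L_{p,∞}`. -/
def weakNorm (p : ℝ) (g : Group m → ℂ) : ℝ≥0∞ :=
  ⨆ (t : ℝ) (_ : 0 < t), ENNReal.ofReal (t ^ p) * haar m {x | t < ‖g x‖}

/-- `g` is the function determined by the martingale `f`: its almost everywhere limit. -/
def IsLimitFunction (f : ℕ → Group m → ℂ) (g : Group m → ℂ) : Prop :=
  Measurable g ∧ ∀ᵐ x ∂(haar m), Tendsto (fun n => f n x) atTop (𝓝 (g x))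

end

end Vilenkin

end

/-!
Both counterexamples are Vilenkin series with a constant coefficient `c_k` on each block
`[M_k, 2 M_k)` and zero coefficients elsewhere. As martingales they have the differences
`c_k r_k D_{M_k}` with `|D_{M_k}| = M_k` on `I_k(0)` and `0` off it, so for `p ≤ 1` the modulus of
continuity at `M_N` is at most `(∑_{k ≥ N} |c_k|^p M_k^{p-1})^{1/p}`.

If the coefficients with indices in `(M_k - q, M_k)` vanish, the second difference of `n σ_n f` at
`M_k` with step `q` is `c_k r_k q K_q`, where `K_q` is the Fejér kernel. Hence `|c_k| |q K_q|` is at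
most `2 M_k` times the sum of `|σ_n f - f|` over `n = M_k + q, M_k, M_k - q`.

For `p < 1/2` take `c_k = M_k` and `q = 1`: that sum is at least `1/2` everywhere. For `p = 1/2`
take `c_k = M_k / k²` on the powers `k` of `2` and `q = M_0 + M_2 + ⋯ + M_{k-2}`. On each of the
`k/2` disjoint sets where `x_{2j}` is the first nonzero coordinate and `x_{2j+1} ≠ 0` also holds,
`|q K_q|` is at least `M_{2j}² / 2`, so each of them contributes at least a constant to
`∫ |q K_q|^{1/2}`. This integral is therefore at least a multiple of `k`, which cancels the factor
`(|c_k| / M_k)^{1/2} = 1/k`.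
-/

namespace Vilenkin

section Digits

variable {m : ℕ → ℕ}

theorem M_succ (k : ℕ) : M m (k + 1) = m k * M m k := rfl

theorem M_dvd {j k : ℕ} (h : j ≤ k) : M m j ∣ M m k := by
  induction k, h using Nat.le_induction with
  | base => exact dvd_rfl
  | succ k _ ih => exact ih.mul_left _

theorem two_mul_M_le (hm : ∀ k, 2 ≤ m k) (k : ℕ) : 2 * M m k ≤ M m (k + 1) :=
  Nat.mul_le_mul_right _ (hm k)

theorem two_pow_mul_M_le (hm : ∀ k, 2 ≤ m k) (N j : ℕ) : 2 ^ j * M m N ≤ M m (N + j) := by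
  induction j with
  | zero => simp
  | succ j ih =>
    calc 2 ^ (j + 1) * M m N = 2 * (2 ^ j * M m N) := by ring
      _ ≤ 2 * M m (N + j) := Nat.mul_le_mul_left _ ih
      _ ≤ M m (N + (j + 1)) := two_mul_M_le hm _

theorem lt_M_of_le (hm : ∀ k, 2 ≤ m k) {n t : ℕ} (h : n ≤ t) : n < M m t :=
  calc n ≤ t := h
    _ < 2 ^ t * M m 0 := by simpa only [M, mul_one] using t.lt_two_pow_self
    _ ≤ M m t := by simpa only [zero_add] using two_pow_mul_M_le hm 0 t

theorem sum_digit_mul_M (n t : ℕ) : ∑ k ∈ Finset.range t, digit m n k * M m k = n % M m t := by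
  induction t with
  | zero => simp [M, Nat.mod_one]
  | succ t ih =>
    rw [Finset.sum_range_succ, ih, M_succ, mul_comm (m t), Nat.mod_mul, digit, mul_comm (M m t)]

theorem eq_of_digit_eq {i j t : ℕ} (hi : i < M m t) (hj : j < M m t)
    (h : ∀ k < t, digit m i k = digit m j k) : i = j :=
  calc i = ∑ k ∈ Finset.range t, digit m i k * M m k := by
        rw [sum_digit_mul_M, Nat.mod_eq_of_lt hi]
    _ = ∑ k ∈ Finset.range t, digit m j k * M m k :=
        Finset.sum_congr rfl fun k hk => by rw [h k (Finset.mem_range.1 hk)]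
    _ = j := by rw [sum_digit_mul_M, Nat.mod_eq_of_lt hj]

variable [∀ k, NeZero (m k)]

theorem M_pos (k : ℕ) : 0 < M m k := by
  induction k with
  | zero => exact one_pos
  | succ k ih => exact Nat.mul_pos (NeZero.pos _) ih

theorem natCast_M_pos (k : ℕ) : (0 : ℝ) < M m k := Nat.cast_pos.2 (M_pos k)

theorem M_mono : Monotone (M m) := fun _ k h => Nat.le_of_dvd (M_pos k) (M_dvd h)

theorem digit_lt (n k : ℕ) : digit m n k < m k := Nat.mod_lt _ (NeZero.pos _)

theorem digit_eq_zero_of_lt {n t k : ℕ} (hn : n < M m t) (hk : t ≤ k) : digit m n k = 0 := by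
  rw [digit, Nat.div_eq_of_lt (hn.trans_le (M_mono hk)), Nat.zero_mod]

theorem digit_mul_M_of_lt (c : ℕ) {t k : ℕ} (hk : k < t) : digit m (c * M m t) k = 0 := by
  obtain ⟨d, hd⟩ := M_dvd (m := m) (Nat.succ_le_of_lt hk)
  rw [digit, hd, M_succ, show c * (m k * M m k * d) = m k * (c * d) * M m k by ring,
    Nat.mul_div_cancel _ (M_pos k), Nat.mul_mod_right]

theorem digit_mul_M_self {u t : ℕ} (hu : u < m t) : digit m (u * M m t) t = u := by
  rw [digit, Nat.mul_div_cancel _ (M_pos t), Nat.mod_eq_of_lt hu]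

theorem digit_add_mul_M {i t : ℕ} (hi : i < M m t) (c k : ℕ) :
    digit m (i + c * M m t) k = digit m i k + digit m (c * M m t) k := by
  rcases lt_or_ge k t with hk | hk
  · rw [digit_mul_M_of_lt c hk, add_zero]
    obtain ⟨d, hd⟩ := M_dvd (m := m) (Nat.succ_le_of_lt hk)
    rw [digit, digit, hd, M_succ, show c * (m k * M m k * d) = M m k * (m k * (c * d)) by ring,
      Nat.add_mul_div_left _ _ (M_pos k), Nat.add_mul_mod_self_left]
  · rw [digit_eq_zero_of_lt hi hk, zero_add]
    obtain ⟨d, hd⟩ := M_dvd (m := m) hk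
    rw [digit, digit, hd, ← Nat.div_div_eq_div_mul, ← Nat.div_div_eq_div_mul,
      Nat.add_mul_div_right _ _ (M_pos t), Nat.div_eq_of_lt hi, zero_add,
      Nat.mul_div_cancel _ (M_pos t)]

end Digits

section Characters

variable {m : ℕ → ℕ} [∀ k, NeZero (m k)]

theorem rademacher_eq_stdAddChar (k : ℕ) (x : Group m) :
    rademacher m k x = ZMod.stdAddChar (x k) := by
  rw [ZMod.stdAddChar_apply, ZMod.toCircle_apply, rademacher]

theorem norm_rademacher (k : ℕ) (x : Group m) : ‖rademacher m k x‖ = 1 := by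
  rw [rademacher_eq_stdAddChar, ZMod.stdAddChar_apply, Circle.norm_coe]

theorem rademacher_eq_one_iff {k : ℕ} {x : Group m} : rademacher m k x = 1 ↔ x k = 0 := by
  rw [rademacher_eq_stdAddChar, ← AddChar.map_zero_eq_one (ZMod.stdAddChar (N := m k))]
  exact ZMod.injective_stdAddChar.eq_iff

theorem rademacher_pow_self (k : ℕ) (x : Group m) : rademacher m k x ^ m k = 1 := by
  rw [rademacher_eq_stdAddChar, ← AddChar.map_nsmul_eq_pow, nsmul_eq_mul, ZMod.natCast_self,
    zero_mul, AddChar.map_zero_eq_one]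

theorem rademacher_sub (k : ℕ) (x y : Group m) :
    rademacher m k (x - y) = rademacher m k x * conj (rademacher m k y) := by
  rw [← Complex.inv_eq_conj (norm_rademacher k y), rademacher_eq_stdAddChar,
    rademacher_eq_stdAddChar, rademacher_eq_stdAddChar, Pi.sub_apply, AddChar.map_sub_eq_div,
    div_eq_mul_inv]

theorem sum_rademacher_pow (k : ℕ) (x : Group m) :
    ∑ u ∈ Finset.range (m k), rademacher m k x ^ u = if x k = 0 then (m k : ℂ) else 0 := by
  split_ifs with h
  · simp [rademacher_eq_one_iff.2 h]
  · rw [geom_sum_eq (mt rademacher_eq_one_iff.1 h), rademacher_pow_self, sub_self, zero_div]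

theorem norm_psi (n : ℕ) (x : Group m) : ‖psi m n x‖ = 1 :=
  finprod_induction (fun z : ℂ => ‖z‖ = 1) norm_one
    (fun z w hz hw => by rw [norm_mul, hz, hw, one_mul])
    fun k => by rw [norm_pow, norm_rademacher, one_pow]

theorem psi_eq_prod {n t : ℕ} (hn : n < M m t) (x : Group m) :
    psi m n x = ∏ k ∈ Finset.range t, rademacher m k x ^ digit m n k := by
  refine finprod_eq_prod_of_mulSupport_subset _ fun k hk => ?_
  by_contra h
  rw [Finset.coe_range, Set.mem_Iio, not_lt] at h
  exact hk (by simp only [digit_eq_zero_of_lt hn h, pow_zero])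

theorem psi_eq_one {n t : ℕ} (hn : n < M m t) {x : Group m} (hx : x ∈ interval m t 0) :
    psi m n x = 1 := by
  rw [psi_eq_prod hn]
  exact Finset.prod_eq_one fun k hk => by
    rw [rademacher_eq_one_iff.2 (hx k (Finset.mem_range.1 hk)), one_pow]

theorem psi_zero (x : Group m) : psi m 0 x = 1 :=
  psi_eq_one (t := 0) one_pos fun _ hk => absurd hk (Nat.not_lt_zero _)

theorem psi_mul_M {u t : ℕ} (hu : u < m t) (x : Group m) :
    psi m (u * M m t) x = rademacher m t x ^ u := by
  rw [psi_eq_prod (t := t + 1) (Nat.mul_lt_mul_of_pos_right hu (M_pos t)),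
    Finset.prod_range_succ, digit_mul_M_self hu, Finset.prod_eq_one, one_mul]
  intro k hk
  rw [digit_mul_M_of_lt _ (Finset.mem_range.1 hk), pow_zero]

theorem psi_add_mul_M (hm : ∀ k, 2 ≤ m k) {i t : ℕ} (hi : i < M m t) (c : ℕ) (x : Group m) :
    psi m (i + c * M m t) x = psi m i x * psi m (c * M m t) x := by
  rw [psi_eq_prod (lt_M_of_le hm le_rfl), psi_eq_prod (lt_M_of_le hm (Nat.le_add_right i _)),
    psi_eq_prod (lt_M_of_le hm (Nat.le_add_left _ i)), ← Finset.prod_mul_distrib]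
  exact Finset.prod_congr rfl fun k _ => by rw [digit_add_mul_M hi, pow_add]

theorem psi_sub (hm : ∀ k, 2 ≤ m k) (n : ℕ) (x y : Group m) :
    psi m n (x - y) = psi m n x * conj (psi m n y) := by
  simp only [psi_eq_prod (lt_M_of_le hm le_rfl), map_prod, map_pow, rademacher_sub, mul_pow,
    Finset.prod_mul_distrib]

end Characters

section Kernels

/-- The Dirichlet kernel `D_n = ∑_{i < n} ψ_i`. -/
noncomputable def dirichletKernel (m : ℕ → ℕ) (n : ℕ) (x : Group m) : ℂ :=
  ∑ i ∈ Finset.range n, psi m i x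

/-- The Fejér kernel, without its normalization: `n K_n = D_1 + ⋯ + D_n`. -/
noncomputable def fejerKernel (m : ℕ → ℕ) (n : ℕ) (x : Group m) : ℂ :=
  ∑ k ∈ Finset.range n, dirichletKernel m (k + 1) x

theorem mem_interval_succ_zero {m : ℕ → ℕ} {t : ℕ} {x : Group m} :
    x ∈ interval m (t + 1) 0 ↔ x ∈ interval m t 0 ∧ x t = 0 := Nat.forall_lt_succ_right

variable {m : ℕ → ℕ} [∀ k, NeZero (m k)] {t : ℕ} {x : Group m}

theorem dirichletKernel_mul_M_add (hm : ∀ k, 2 ≤ m k) (c : ℕ) {s : ℕ} (hs : s ≤ M m t)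
    (x : Group m) :
    dirichletKernel m (c * M m t + s) x =
      dirichletKernel m (c * M m t) x + psi m (c * M m t) x * dirichletKernel m s x := by
  rw [dirichletKernel, Finset.sum_range_add, dirichletKernel, dirichletKernel, Finset.mul_sum]
  congr 1
  refine Finset.sum_congr rfl fun i hi => ?_
  rw [add_comm, psi_add_mul_M hm ((Finset.mem_range.1 hi).trans_le hs), mul_comm]

theorem dirichletKernel_mul_M (hm : ∀ k, 2 ≤ m k) (c t : ℕ) (x : Group m) :
    dirichletKernel m (c * M m t) x =
      (∑ u ∈ Finset.range c, psi m (u * M m t) x) * dirichletKernel m (M m t) x := by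
  induction c with
  | zero => simp [dirichletKernel]
  | succ c ih =>
    rw [Nat.succ_mul, dirichletKernel_mul_M_add hm c le_rfl, ih, Finset.sum_range_succ, add_mul]

theorem sum_psi_mul_M (t : ℕ) (x : Group m) :
    ∑ u ∈ Finset.range (m t), psi m (u * M m t) x = if x t = 0 then (m t : ℂ) else 0 := by
  rw [← sum_rademacher_pow]
  exact Finset.sum_congr rfl fun u hu => psi_mul_M (Finset.mem_range.1 hu) x

/-- Paley's lemma. -/
theorem dirichletKernel_M (hm : ∀ k, 2 ≤ m k) (t : ℕ) (x : Group m) :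
    dirichletKernel m (M m t) x = (interval m t 0).indicator (fun _ => (M m t : ℂ)) x := by
  classical
  induction t with
  | zero => simp [dirichletKernel, M, psi_zero, interval]
  | succ t ih =>
    rw [M_succ, dirichletKernel_mul_M hm, sum_psi_mul_M, ih]
    by_cases h : x t = 0 <;>
      simp [h, Set.indicator_apply, mem_interval_succ_zero]

theorem dirichletKernel_M_eq_zero (hm : ∀ k, 2 ≤ m k) {k : ℕ} (hk : k < t) (hx : x k ≠ 0) :
    dirichletKernel m (M m t) x = 0 := by
  have hmem : x ∉ interval m t 0 := fun h => hx (h k hk)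
  rw [dirichletKernel_M hm, Set.indicator_of_notMem hmem]

theorem dirichletKernel_of_mem_interval {n : ℕ} (hn : n ≤ M m t) (hx : x ∈ interval m t 0) :
    dirichletKernel m n x = n := by
  rw [dirichletKernel, Finset.sum_congr rfl fun i hi =>
    psi_eq_one ((Finset.mem_range.1 hi).trans_le hn) hx]
  simp

theorem fejerKernel_mul_M_add (hm : ∀ k, 2 ≤ m k) (hx : dirichletKernel m (M m t) x = 0) (c : ℕ)
    {r : ℕ} (hr : r ≤ M m t) :
    fejerKernel m (c * M m t + r) x =
      fejerKernel m (c * M m t) x + psi m (c * M m t) x * fejerKernel m r x := by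
  rw [fejerKernel, Finset.sum_range_add, fejerKernel, fejerKernel, Finset.mul_sum]
  congr 1
  refine Finset.sum_congr rfl fun k hk => ?_
  have hk' : k + 1 ≤ M m t := (Nat.succ_le_of_lt (Finset.mem_range.1 hk)).trans hr
  rw [add_assoc, dirichletKernel_mul_M_add hm c hk', dirichletKernel_mul_M hm c t, hx, mul_zero,
    zero_add]

theorem fejerKernel_mul_M (hm : ∀ k, 2 ≤ m k) (hx : dirichletKernel m (M m t) x = 0) (c : ℕ) :
    fejerKernel m (c * M m t) x =
      (∑ u ∈ Finset.range c, psi m (u * M m t) x) * fejerKernel m (M m t) x := by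
  induction c with
  | zero => simp [fejerKernel]
  | succ c ih =>
    rw [Nat.succ_mul, fejerKernel_mul_M_add hm hx c le_rfl, ih, Finset.sum_range_succ, add_mul]

theorem fejerKernel_M_add_two_eq_zero (hm : ∀ k, 2 ≤ m k) (h : x t ≠ 0) (h' : x (t + 1) ≠ 0) :
    fejerKernel m (M m (t + 2)) x = 0 := by
  have hD : dirichletKernel m (M m (t + 1)) x = 0 :=
    dirichletKernel_M_eq_zero hm (Nat.lt_succ_self t) h
  rw [M_succ, fejerKernel_mul_M hm hD, sum_psi_mul_M, if_neg h', zero_mul]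

theorem fejerKernel_mul_M_add_two_add (hm : ∀ k, 2 ≤ m k) (h : x t ≠ 0) (h' : x (t + 1) ≠ 0)
    (c : ℕ) {r : ℕ} (hr : r ≤ M m (t + 2)) :
    fejerKernel m (c * M m (t + 2) + r) x = psi m (c * M m (t + 2)) x * fejerKernel m r x := by
  have hD : dirichletKernel m (M m (t + 2)) x = 0 :=
    dirichletKernel_M_eq_zero hm (Nat.lt_succ_self (t + 1)) h'
  rw [fejerKernel_mul_M_add hm hD c hr, fejerKernel_mul_M hm hD,
    fejerKernel_M_add_two_eq_zero hm h h', mul_zero, zero_add]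

theorem sub_le_re_dirichletKernel_M_add (hx : x ∈ interval m t 0) (s : ℕ) :
    (M m t : ℝ) - s ≤ (dirichletKernel m (M m t + s) x).re := by
  have htail : ‖∑ i ∈ Finset.range s, psi m (M m t + i) x‖ ≤ s :=
    (norm_sum_le _ _).trans (by simp [norm_psi])
  have hsplit : dirichletKernel m (M m t + s) x =
      M m t + ∑ i ∈ Finset.range s, psi m (M m t + i) x := by
    rw [← dirichletKernel_of_mem_interval le_rfl hx]
    exact Finset.sum_range_add _ _ _
  rw [hsplit, Complex.add_re, Complex.natCast_re]
  linarith [neg_le_of_abs_le (Complex.abs_re_le_norm (∑ i ∈ Finset.range s, psi m (M m t + i) x))]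

theorem sq_M_div_two_le_norm_fejerKernel {s : ℕ} (hs : s ≤ M m t) (hx : x ∈ interval m t 0) :
    (M m t : ℝ) ^ 2 / 2 ≤ ‖fejerKernel m (M m t + s) x‖ := by
  have hhead : ∑ k ∈ Finset.range (M m t), (dirichletKernel m (k + 1) x).re =
      (M m t : ℝ) * (M m t + 1) / 2 := by
    have hgauss : ∀ n : ℕ, ∑ k ∈ Finset.range n, ((k : ℝ) + 1) = n * (n + 1) / 2 := fun n => by
      induction n with
      | zero => simp
      | succ n ih => rw [Finset.sum_range_succ, ih]; push_cast; ring
    rw [← hgauss]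
    refine Finset.sum_congr rfl fun k hk => ?_
    rw [dirichletKernel_of_mem_interval (Nat.succ_le_of_lt (Finset.mem_range.1 hk)) hx]
    simp
  have htail : 0 ≤ ∑ k ∈ Finset.range s, (dirichletKernel m (M m t + k + 1) x).re := by
    refine Finset.sum_nonneg fun k hk => ?_
    have hk' : ((k + 1 : ℕ) : ℝ) ≤ M m t :=
      Nat.cast_le.2 ((Nat.succ_le_of_lt (Finset.mem_range.1 hk)).trans hs)
    exact (sub_nonneg.2 hk').trans (sub_le_re_dirichletKernel_M_add hx (k + 1))
  calc (M m t : ℝ) ^ 2 / 2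
      ≤ M m t * (M m t + 1) / 2 := by linarith [natCast_M_pos (m := m) t]
    _ ≤ (fejerKernel m (M m t + s) x).re := by
        rw [fejerKernel, Finset.sum_range_add, Complex.add_re, Complex.re_sum, Complex.re_sum,
          hhead]
        exact le_add_of_nonneg_right htail
    _ ≤ ‖fejerKernel m (M m t + s) x‖ := Complex.re_le_norm _

end Kernels

section Measurability

theorem isPiSystem_range_interval (m : ℕ → ℕ) (n : ℕ) :
    IsPiSystem (Set.range (interval m n)) := by
  rintro _ ⟨x, rfl⟩ _ ⟨y, rfl⟩ ⟨z, hzx, hzy⟩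
  refine ⟨z, Set.Subset.antisymm (fun w hw => ⟨fun k hk => ?_, fun k hk => ?_⟩) ?_⟩
  · rw [hw k hk, hzx k hk]
  · rw [hw k hk, hzy k hk]
  · rintro w ⟨hw, -⟩ k hk
    rw [hw k hk, hzx k hk]

variable {m : ℕ → ℕ} [∀ k, NeZero (m k)]

theorem measurableSet_sigmaAlg {n : ℕ} {s : Set (Group m)} (hs : ∀ x ∈ s, interval m n x ⊆ s) :
    MeasurableSet[sigmaAlg m n] s := by
  classical
  let e : (∀ j : Fin n, ZMod (m j)) → Group m := fun z k => if h : k < n then z ⟨k, h⟩ else 0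
  have hcover : s = ⋃ z ∈ e ⁻¹' s, interval m n (e z) := by
    refine Set.Subset.antisymm (fun x hx => ?_) (Set.iUnion₂_subset fun z hz => hs _ hz)
    have he : e (fun j => x j) ∈ interval m n x := fun k hk => by simp [e, hk]
    exact Set.mem_iUnion₂.2 ⟨fun j => x j, hs x hx he, fun k hk => (he k hk).symm⟩
  rw [hcover]
  exact @MeasurableSet.biUnion _ _ (sigmaAlg m n) _ _ (Set.to_countable _) fun z _ =>
    MeasurableSpace.measurableSet_generateFrom ⟨_, rfl⟩

theorem measurable_psi_sigmaAlg {i n : ℕ} (hi : i < M m n) :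
    Measurable[sigmaAlg m n] (psi m i) := by
  have hconst : ∀ x, ∀ y ∈ interval m n x, psi m i y = psi m i x := fun x y hy => by
    rw [psi_eq_prod hi, psi_eq_prod hi]
    exact Finset.prod_congr rfl fun k hk => by
      rw [rademacher, rademacher, hy k (Finset.mem_range.1 hk)]
  exact fun s _ => measurableSet_sigmaAlg fun x hx y hy => by
    rwa [Set.mem_preimage, hconst x y hy]

theorem measurable_psi (hm : ∀ k, 2 ≤ m k) (i : ℕ) : Measurable (psi m i) :=
  (measurable_psi_sigmaAlg (lt_M_of_le hm le_rfl)).mono ((filtration m).le i) le_rfl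

theorem integrable_psi (hm : ∀ k, 2 ≤ m k) (i : ℕ) : Integrable (psi m i) (haar m) :=
  .of_bound (measurable_psi hm i).aestronglyMeasurable 1 (ae_of_all _ fun x => (norm_psi i x).le)

theorem integrable_psi_mul_conj (hm : ∀ k, 2 ≤ m k) (i j : ℕ) :
    Integrable (fun x => psi m i x * conj (psi m j x)) (haar m) := by
  have hmeas : Measurable fun x => psi m i x * conj (psi m j x) :=
    (measurable_psi hm i).mul (Complex.continuous_conj.measurable.comp (measurable_psi hm j))
  refine .of_bound hmeas.aestronglyMeasurable 1 (ae_of_all _ fun x => ?_)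
  rw [norm_mul, RCLike.norm_conj, norm_psi, norm_psi, one_mul]

end Measurability

section Haar

variable {m : ℕ → ℕ} [∀ k, NeZero (m k)]

theorem haar_setOf_forall_mem (t : ℕ) (s : ∀ k, Finset (ZMod (m k))) :
    haar m {x | ∀ k < t, x k ∈ s k} =
      ∏ k ∈ Finset.range t, ((s k).card : ℝ≥0∞) / (m k : ℝ≥0∞) := by
  have h := Measure.infinitePi_pi (fun k => (PMF.uniformOfFintype (ZMod (m k))).toMeasure)
    (s := Finset.range t) (t := fun k => (s k : Set (ZMod (m k)))) fun k _ => (s k).measurableSet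
  have hset : {x : Group m | ∀ k < t, x k ∈ s k} =
      Set.pi (Finset.range t : Set ℕ) fun k => (s k : Set (ZMod (m k))) := by
    ext x; simp [Set.mem_pi]
  rw [haar, hset, h]
  refine Finset.prod_congr rfl fun k _ => ?_
  rw [PMF.toMeasure_uniformOfFintype_apply _ (s k).measurableSet, ZMod.card]
  simp

theorem haar_interval (t : ℕ) (y : Group m) : haar m (interval m t y) = (M m t : ℝ≥0∞)⁻¹ := by
  have h := haar_setOf_forall_mem t fun k => {y k}
  simp only [Finset.mem_singleton, Finset.card_singleton, Nat.cast_one, one_div] at h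
  rw [interval, h]
  clear h
  induction t with
  | zero => simp [M]
  | succ t ih =>
    rw [Finset.prod_range_succ, ih, M_succ, Nat.cast_mul, mul_comm, ENNReal.mul_inv]
    · exact Or.inl (Nat.cast_ne_zero.2 (NeZero.ne _))
    · exact Or.inl (ENNReal.natCast_ne_top _)

theorem ae_exists_ne_zero (hm : ∀ k, 2 ≤ m k) : ∀ᵐ x ∂(haar m), ∃ k, x k ≠ 0 := by
  have hle : ∀ n : ℕ, haar m {x | ¬∃ k, x k ≠ 0} ≤ (n : ℝ≥0∞)⁻¹ := fun n =>
    calc haar m {x | ¬∃ k, x k ≠ 0}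
        ≤ haar m (interval m n 0) := measure_mono fun x hx k _ => not_not.1 fun h => hx ⟨k, h⟩
      _ = (M m n : ℝ≥0∞)⁻¹ := haar_interval n 0
      _ ≤ (n : ℝ≥0∞)⁻¹ := ENNReal.inv_le_inv.2 (Nat.cast_le.2 (lt_M_of_le hm le_rfl).le)
  exact ae_iff.2 <| le_antisymm (ge_of_tendsto' ENNReal.tendsto_inv_nat_nhds_zero hle) zero_le

theorem integral_prod_haar (t : ℕ) (g : ∀ k, ZMod (m k) → ℂ) :
    ∫ x, ∏ k ∈ Finset.range t, g k (x k) ∂(haar m) =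
      ∏ k ∈ Finset.range t, (m k : ℂ)⁻¹ * ∑ z, g k z := by
  have hmeas : Measurable fun y : ∀ k : Finset.range t, ZMod (m k) =>
      ∏ k : Finset.range t, g k (y k) :=
    Finset.measurable_prod _ fun k _ => measurable_from_top.comp (measurable_pi_apply k)
  calc ∫ x, ∏ k ∈ Finset.range t, g k (x k) ∂(haar m)
      = ∫ x, ∏ k : Finset.range t, g k ((Finset.range t).restrict x k) ∂(haar m) :=
        integral_congr_ae (ae_of_all _ fun x => (Finset.prod_attach _ fun k => g k (x k)).symm)
    _ = ∏ k : Finset.range t, ∫ z, g k z ∂(PMF.uniformOfFintype (ZMod (m k))).toMeasure :=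
        (integral_restrict_infinitePi
          (μ := fun k => (PMF.uniformOfFintype (ZMod (m k))).toMeasure)
          hmeas.aestronglyMeasurable).trans
          (integral_fintype_prod_eq_prod fun (k : Finset.range t) (z : ZMod (m k)) => g k z)
    _ = ∏ k ∈ Finset.range t, ∫ z, g k z ∂(PMF.uniformOfFintype (ZMod (m k))).toMeasure :=
        Finset.prod_attach _ fun k => ∫ z, g k z ∂(PMF.uniformOfFintype (ZMod (m k))).toMeasure
    _ = ∏ k ∈ Finset.range t, (m k : ℂ)⁻¹ * ∑ z, g k z :=
        Finset.prod_congr rfl fun k _ => by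
          simp [PMF.integral_eq_sum, Finset.mul_sum, ZMod.card, Complex.real_smul]

end Haar

section Orthogonality

theorem sum_stdAddChar_pow_mul_conj {N a b : ℕ} [NeZero N] (ha : a < N) (hb : b < N) :
    ∑ z : ZMod N, ZMod.stdAddChar z ^ a * conj (ZMod.stdAddChar z ^ b) =
      if a = b then (N : ℂ) else 0 := by
  have hterm : ∀ z : ZMod N, ZMod.stdAddChar z ^ a * conj (ZMod.stdAddChar z ^ b) =
      ZMod.stdAddChar (z * ((a : ZMod N) - (b : ZMod N))) := fun z => by
    have hz : ‖ZMod.stdAddChar z ^ b‖ = 1 := by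
      rw [norm_pow, ZMod.stdAddChar_apply, Circle.norm_coe, one_pow]
    rw [← Complex.inv_eq_conj hz, mul_sub, AddChar.map_sub_eq_div, div_eq_mul_inv,
      mul_comm z, mul_comm z, ← nsmul_eq_mul, ← nsmul_eq_mul, AddChar.map_nsmul_eq_pow,
      AddChar.map_nsmul_eq_pow]
  have hab : (a : ZMod N) - (b : ZMod N) = 0 ↔ a = b := by
    rw [sub_eq_zero, ZMod.natCast_eq_natCast_iff]
    exact ⟨fun h => Nat.ModEq.eq_of_lt_of_lt h ha hb, fun h => h ▸ rfl⟩
  simp only [hterm, AddChar.sum_mulShift _ (ZMod.isPrimitive_stdAddChar N), hab, ZMod.card,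
    Nat.cast_ite, Nat.cast_zero]

variable {m : ℕ → ℕ} [∀ k, NeZero (m k)]

theorem integral_psi_mul_conj (hm : ∀ k, 2 ≤ m k) (i j : ℕ) :
    ∫ x, psi m i x * conj (psi m j x) ∂(haar m) = if i = j then 1 else 0 := by
  have hi : i < M m (max i j) := lt_M_of_le hm (le_max_left _ _)
  have hj : j < M m (max i j) := lt_M_of_le hm (le_max_right _ _)
  have hint : ∀ x : Group m, psi m i x * conj (psi m j x) =
      ∏ k ∈ Finset.range (max i j), ZMod.stdAddChar (x k) ^ digit m i k *
        conj (ZMod.stdAddChar (x k) ^ digit m j k) := fun x => by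
    rw [psi_eq_prod hi, psi_eq_prod hj, map_prod, ← Finset.prod_mul_distrib]
    simp only [rademacher_eq_stdAddChar]
  simp only [hint]
  rw [integral_prod_haar _ fun k z =>
    ZMod.stdAddChar z ^ digit m i k * conj (ZMod.stdAddChar z ^ digit m j k)]
  simp only [sum_stdAddChar_pow_mul_conj (digit_lt _ _) (digit_lt _ _)]
  split_ifs with hij
  · exact Finset.prod_eq_one fun k _ => by rw [hij, if_pos rfl, inv_mul_cancel₀ (NeZero.ne _)]
  · obtain ⟨k, hk, hne⟩ : ∃ k < max i j, digit m i k ≠ digit m j k := by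
      by_contra! hcon
      exact hij (eq_of_digit_eq hi hj hcon)
    exact Finset.prod_eq_zero (Finset.mem_range.2 hk) (by rw [if_neg hne, mul_zero])

theorem indicator_interval_eq_sum (hm : ∀ k, 2 ≤ m k) (n : ℕ) (y x : Group m) :
    (interval m n y).indicator (fun _ => (1 : ℂ)) x =
      (M m n : ℂ)⁻¹ * ∑ i ∈ Finset.range (M m n), psi m i y * conj (psi m i x) := by
  have hpaley := dirichletKernel_M hm n (y - x)
  simp only [dirichletKernel, psi_sub hm] at hpaley
  have hmem : y - x ∈ interval m n 0 ↔ x ∈ interval m n y :=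
    forall₂_congr fun k _ => sub_eq_zero.trans eq_comm
  have hM : (M m n : ℂ) ≠ 0 := Nat.cast_ne_zero.2 (M_pos n).ne'
  rw [hpaley]
  by_cases hx : x ∈ interval m n y
  · rw [Set.indicator_of_mem hx, Set.indicator_of_mem (hmem.2 hx), inv_mul_cancel₀ hM]
  · rw [Set.indicator_of_notMem hx, Set.indicator_of_notMem (mt hmem.1 hx), mul_zero]

theorem setIntegral_interval_psi (hm : ∀ k, 2 ≤ m k) {n j : ℕ} (hj : M m n ≤ j) (y : Group m) :
    ∫ x in interval m n y, psi m j x ∂(haar m) = 0 := by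
  have hexpand : ∀ x, (interval m n y).indicator (psi m j) x =
      ∑ i ∈ Finset.range (M m n), (M m n : ℂ)⁻¹ * psi m i y *
        (psi m j x * conj (psi m i x)) := fun x => by
    have hmul : (interval m n y).indicator (psi m j) x =
        (interval m n y).indicator (fun _ => (1 : ℂ)) x * psi m j x := by
      by_cases hx : x ∈ interval m n y <;> simp [hx]
    rw [hmul, indicator_interval_eq_sum hm, Finset.mul_sum, Finset.sum_mul]
    exact Finset.sum_congr rfl fun i _ => by ring
  rw [← integral_indicator (measurableSet_interval m n y)]
  simp only [hexpand]
  rw [integral_finsetSum _ fun i _ => (integrable_psi_mul_conj hm j i).const_mul _]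
  refine Finset.sum_eq_zero fun i hi => ?_
  rw [integral_const_mul, integral_psi_mul_conj hm,
    if_neg ((Finset.mem_range.1 hi).trans_le hj).ne', mul_zero]

theorem setIntegral_psi (hm : ∀ k, 2 ≤ m k) {n j : ℕ} (hj : M m n ≤ j) {s : Set (Group m)}
    (hs : MeasurableSet[sigmaAlg m n] s) : ∫ x in s, psi m j x ∂(haar m) = 0 := by
  have hle : sigmaAlg m n ≤ MeasurableSpace.pi := (filtration m).le n
  have huniv : ∫ x, psi m j x ∂(haar m) = 0 := by
    have h := integral_psi_mul_conj hm j 0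
    rw [if_neg ((M_pos n).trans_le hj).ne'] at h
    simpa [psi_zero] using h
  induction s, hs using MeasurableSpace.induction_on_inter (m := sigmaAlg m n) rfl
    (isPiSystem_range_interval m n) with
  | empty => simp
  | basic _ ht =>
    obtain ⟨y, rfl⟩ := ht
    exact setIntegral_interval_psi hm hj y
  | compl t ht ih =>
    have h := integral_add_compl (hle _ ht) (integrable_psi hm j)
    rwa [ih, huniv, zero_add] at h
  | iUnion f hd hf ih =>
    rw [integral_iUnion (fun i => hle _ (hf i)) hd (integrable_psi hm j).integrableOn]
    simp [ih]

end Orthogonality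

section Series

/-- The partial sums `∑_{i < n} a_i ψ_i` of a Vilenkin series. -/
noncomputable def seriesSum (m : ℕ → ℕ) (a : ℕ → ℂ) (n : ℕ) (x : Group m) : ℂ :=
  ∑ i ∈ Finset.range n, a i * psi m i x

/-- The martingale formed by the partial sums of order `M_n` of a Vilenkin series. -/
noncomputable def seriesMartingale (m : ℕ → ℕ) (a : ℕ → ℂ) (n : ℕ) : Group m → ℂ :=
  seriesSum m a (M m n)

variable {m : ℕ → ℕ} [∀ k, NeZero (m k)]

theorem integrable_seriesSum (hm : ∀ k, 2 ≤ m k) (a : ℕ → ℂ) (n : ℕ) :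
    Integrable (seriesSum m a n) (haar m) :=
  integrable_finsetSum _ fun i _ => (integrable_psi hm i).const_mul _

theorem measurable_seriesMartingale (a : ℕ → ℂ) (n : ℕ) :
    Measurable[sigmaAlg m n] (seriesMartingale m a n) :=
  Finset.measurable_sum _ fun _ hi =>
    (measurable_psi_sigmaAlg (Finset.mem_range.1 hi)).const_mul _

theorem martingale_seriesMartingale (hm : ∀ k, 2 ≤ m k) (a : ℕ → ℂ) :
    Martingale (seriesMartingale m a) (filtration m) (haar m) := by
  refine martingale_of_setIntegral_eq_succ
    (fun n => (measurable_seriesMartingale a n).stronglyMeasurable)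
    (fun n => integrable_seriesSum hm a (M m n)) fun n s hs => ?_
  have hsplit : ∀ x, seriesMartingale m a (n + 1) x = seriesMartingale m a n x +
      ∑ i ∈ Finset.Ico (M m n) (M m (n + 1)), a i * psi m i x := fun x =>
    (Finset.sum_range_add_sum_Ico _ (M_mono n.le_succ)).symm
  have hint : ∀ i, Integrable (fun x => a i * psi m i x) ((haar m).restrict s) := fun i =>
    ((integrable_psi hm i).const_mul _).restrict
  have hzero : ∑ i ∈ Finset.Ico (M m n) (M m (n + 1)),
      ∫ x in s, a i * psi m i x ∂(haar m) = 0 := Finset.sum_eq_zero fun i hi => by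
    rw [integral_const_mul, setIntegral_psi hm (Finset.mem_Ico.1 hi).1 hs, mul_zero]
  simp only [hsplit]
  rw [integral_add (f := seriesMartingale m a n) (integrable_seriesSum hm a _).restrict
    (integrable_finsetSum _ fun i _ => hint i), integral_finsetSum _ fun i _ => hint i, hzero,
    add_zero]

theorem coeffFun_seriesSum (hm : ∀ k, 2 ≤ m k) (a : ℕ → ℂ) (n i : ℕ) :
    coeffFun m (seriesSum m a n) i = if i < n then a i else 0 := by
  have hexpand : ∀ x, seriesSum m a n x * conj (psi m i x) =
      ∑ j ∈ Finset.range n, a j * (psi m j x * conj (psi m i x)) := fun x => by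
    rw [seriesSum, Finset.sum_mul]
    exact Finset.sum_congr rfl fun j _ => mul_assoc _ _ _
  simp only [coeffFun, hexpand]
  rw [integral_finsetSum _ fun j _ => (integrable_psi_mul_conj hm j i).const_mul _]
  simp [integral_const_mul, integral_psi_mul_conj hm]

theorem coeff_seriesMartingale (hm : ∀ k, 2 ≤ m k) (a : ℕ → ℂ) (i : ℕ) :
    coeff m (seriesMartingale m a) i = a i := by
  refine Tendsto.limUnder_eq (tendsto_const_nhds.congr' ?_)
  filter_upwards [eventually_ge_atTop i] with k hk
  rw [seriesMartingale, coeffFun_seriesSum hm, if_pos (lt_M_of_le hm hk)]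

theorem partialSum_seriesMartingale (hm : ∀ k, 2 ≤ m k) (a : ℕ → ℂ) (n : ℕ) (x : Group m) :
    partialSum m (seriesMartingale m a) n x = seriesSum m a n x := by
  simp only [partialSum, coeff_seriesMartingale hm, seriesSum]

theorem partialSumFun_seriesMartingale (hm : ∀ k, 2 ≤ m k) (a : ℕ → ℂ) (k N : ℕ) (x : Group m) :
    partialSumFun m (seriesMartingale m a k) (M m N) x = seriesMartingale m a (min N k) x := by
  have hrange : (Finset.range (M m N)).filter (· < M m k) = Finset.range (M m (min N k)) := by
    ext i
    simp [M_mono.map_min]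
  simp only [partialSumFun, seriesMartingale, coeffFun_seriesSum hm, ite_mul, zero_mul, seriesSum]
  rw [← Finset.sum_filter, hrange]

theorem natCast_mul_fejer (f : ℕ → Group m → ℂ) (n : ℕ) (x : Group m) :
    (n : ℂ) * fejer m f n x = ∑ k ∈ Finset.range n, partialSum m f (k + 1) x := by
  rw [fejer, Finset.range_eq_Ico, Finset.sum_Ico_add' (fun k => partialSum m f k x) 0 n 1,
    zero_add, Finset.Ico_add_one_right_eq_Icc, ← mul_assoc]
  rcases eq_or_ne n 0 with rfl | hn
  · simp
  · rw [mul_one_div_cancel (Nat.cast_ne_zero.2 hn), one_mul]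

theorem measurable_fejer (hm : ∀ k, 2 ≤ m k) (f : ℕ → Group m → ℂ) (n : ℕ) :
    Measurable (fejer m f n) :=
  (Finset.measurable_sum _ fun _ _ => Finset.measurable_sum _ fun i _ =>
    (measurable_psi hm i).const_mul _).const_mul _

end Series

section SecondDifference

theorem sum_partial_sums_second_difference {E : Type*} [AddCommGroup E] {u : ℕ → E} {n q : ℕ}
    (hu : ∀ i, 0 < i → i < q → u (n + i) = 0) :
    (∑ k ∈ Finset.range (n + q + q), ∑ i ∈ Finset.range (k + 1), u i -
        ∑ k ∈ Finset.range (n + q), ∑ i ∈ Finset.range (k + 1), u i) -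
      (∑ k ∈ Finset.range (n + q), ∑ i ∈ Finset.range (k + 1), u i -
        ∑ k ∈ Finset.range n, ∑ i ∈ Finset.range (k + 1), u i) =
      ∑ k ∈ Finset.range q, ∑ i ∈ Finset.range (k + 1), u (n + q + i) := by
  have hgap : ∀ j, 0 < j → j ≤ q →
      ∑ i ∈ Finset.range (n + j), u i = ∑ i ∈ Finset.range n, u i + u n := fun j hj hjq => by
    rw [Finset.sum_range_add, Finset.sum_eq_single_of_mem 0 (Finset.mem_range.2 hj)
      fun i hi h0 => hu i (Nat.pos_of_ne_zero h0) ((Finset.mem_range.1 hi).trans_le hjq), add_zero]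
  rw [Finset.sum_range_add _ (n + q) q, add_sub_cancel_left, Finset.sum_range_add _ n q,
    add_sub_cancel_left, ← Finset.sum_sub_distrib]
  refine Finset.sum_congr rfl fun k hk => ?_
  have hkq : k < q := Finset.mem_range.1 hk
  rw [add_assoc (n + q), Finset.sum_range_add, add_assoc n k, hgap (k + 1) k.succ_pos hkq,
    hgap q (k.zero_le.trans_lt hkq) le_rfl, add_sub_cancel_left]

variable {m : ℕ → ℕ} [∀ k, NeZero (m k)]

theorem fejer_second_difference (hm : ∀ k, 2 ≤ m k) {a : ℕ → ℂ} {n q : ℕ}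
    (ha : ∀ i, 0 < i → i < q → a (n + i) = 0) (x : Group m) :
    ((n + q + q : ℕ) : ℂ) * fejer m (seriesMartingale m a) (n + q + q) x -
        2 * (((n + q : ℕ) : ℂ) * fejer m (seriesMartingale m a) (n + q) x) +
        n * fejer m (seriesMartingale m a) n x =
      ∑ k ∈ Finset.range q, ∑ i ∈ Finset.range (k + 1), a (n + q + i) * psi m (n + q + i) x := by
  rw [← sum_partial_sums_second_difference (u := fun i => a i * psi m i x)
    fun i h0 hi => by rw [ha i h0 hi, zero_mul]]
  simp only [natCast_mul_fejer, partialSum_seriesMartingale hm, seriesSum]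
  ring

end SecondDifference

section BlockMartingale

/-- The coefficient sequence with the value `c_k` on the block `[M_k, 2 M_k)` for every `k`, and
`0` elsewhere. At most one summand is nonzero, and `M_k ≤ i` forces `k < i`. -/
noncomputable def blockCoeff (m : ℕ → ℕ) (c : ℕ → ℂ) (i : ℕ) : ℂ :=
  ∑ k ∈ Finset.range i, if M m k ≤ i ∧ i < 2 * M m k then c k else 0

/-- The martingale with Vilenkin–Fourier coefficients `blockCoeff m c`; its differences are
`c_k r_k D_{M_k}`. -/
noncomputable def blockMartingale (m : ℕ → ℕ) (c : ℕ → ℂ) : ℕ → Group m → ℂ :=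
  seriesMartingale m (blockCoeff m c)

variable {m : ℕ → ℕ} [∀ k, NeZero (m k)]

theorem blockCoeff_eq (hm : ∀ k, 2 ≤ m k) (c : ℕ → ℂ) {i k : ℕ} (h : M m k ≤ i)
    (h' : i < M m (k + 1)) : blockCoeff m c i = if i < 2 * M m k then c k else 0 := by
  rw [blockCoeff, Finset.sum_eq_single_of_mem k
    (Finset.mem_range.2 ((lt_M_of_le hm le_rfl).trans_le h)) fun j _ hj => if_neg fun hji => ?_]
  · simp [h]
  · rcases hj.lt_or_gt with hlt | hlt
    · exact absurd (hji.2.trans_le (two_mul_M_le hm j)) (not_lt.2 ((M_mono hlt).trans h))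
    · exact absurd hji.1 (not_le.2 (h'.trans_le (M_mono hlt)))

theorem blockCoeff_M_add (hm : ∀ k, 2 ≤ m k) (c : ℕ → ℂ) {i k : ℕ} (hi : i < M m k) :
    blockCoeff m c (M m k + i) = c k := by
  have hlt : M m k + i < 2 * M m k := by omega
  rw [blockCoeff_eq hm c (Nat.le_add_right _ _) (hlt.trans_le (two_mul_M_le hm k)), if_pos hlt]

theorem psi_M_add (hm : ∀ k, 2 ≤ m k) {i k : ℕ} (hi : i < M m k) (x : Group m) :
    psi m (M m k + i) x = rademacher m k x * psi m i x := by
  have h := psi_add_mul_M hm hi 1 x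
  rwa [psi_mul_M (hm k), one_mul, pow_one, add_comm, mul_comm] at h

theorem blockMartingale_succ (hm : ∀ k, 2 ≤ m k) (c : ℕ → ℂ) (n : ℕ) (x : Group m) :
    blockMartingale m c (n + 1) x = blockMartingale m c n x +
      c n * (rademacher m n x * dirichletKernel m (M m n) x) := by
  obtain ⟨r, hr⟩ := Nat.exists_eq_add_of_le (two_mul_M_le hm n)
  have htail : ∀ i < r, blockCoeff m c (2 * M m n + i) = 0 := fun i hi => by
    rw [blockCoeff_eq hm c (k := n) (by omega) (by omega), if_neg (by omega)]
  rw [blockMartingale, seriesMartingale, seriesSum, hr, Finset.sum_range_add, two_mul,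
    Finset.sum_range_add, ← two_mul, Finset.sum_eq_zero (s := Finset.range r) fun i hi => by
      rw [htail i (Finset.mem_range.1 hi), zero_mul], add_zero, dirichletKernel, Finset.mul_sum,
    Finset.mul_sum]
  refine congrArg₂ _ rfl (Finset.sum_congr rfl fun i hi => ?_)
  rw [blockCoeff_M_add hm c (Finset.mem_range.1 hi), psi_M_add hm (Finset.mem_range.1 hi)]

theorem blockMartingale_eq_sum (hm : ∀ k, 2 ≤ m k) (c : ℕ → ℂ) (n : ℕ) (x : Group m) :
    blockMartingale m c n x =
      ∑ k ∈ Finset.range n, c k * (rademacher m k x * dirichletKernel m (M m k) x) := by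
  induction n with
  | zero => simp [blockMartingale, seriesMartingale, seriesSum, blockCoeff, M]
  | succ n ih => rw [blockMartingale_succ hm, ih, Finset.sum_range_succ]

theorem sub_partialSumFun_blockMartingale (hm : ∀ k, 2 ≤ m k) (c : ℕ → ℂ) (N k : ℕ)
    (x : Group m) :
    blockMartingale m c k x - partialSumFun m (blockMartingale m c k) (M m N) x =
      blockMartingale m ((Set.Ici N).indicator c) k x := by
  have hpartial : partialSumFun m (blockMartingale m c k) (M m N) x =
      blockMartingale m c (min N k) x := partialSumFun_seriesMartingale hm _ k N x
  rw [hpartial]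
  simp only [blockMartingale_eq_sum hm]
  rw [← Finset.sum_sdiff_eq_sub (Finset.range_mono (min_le_right N k))]
  refine Finset.sum_subset_zero_on_sdiff Finset.sdiff_subset (fun i hi => ?_) fun i hi => ?_
  · have hiN : i < N := by
      simp only [Finset.mem_sdiff, Finset.mem_range] at hi
      omega
    rw [Set.indicator_of_notMem (by simpa using hiN), zero_mul]
  · have hiN : N ≤ i := by
      simp only [Finset.mem_sdiff, Finset.mem_range] at hi
      omega
    rw [Set.indicator_of_mem (Set.mem_Ici.2 hiN)]

theorem exists_isLimitFunction_blockMartingale (hm : ∀ k, 2 ≤ m k) (c : ℕ → ℂ) :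
    ∃ g, IsLimitFunction m (blockMartingale m c) g := by
  have hmeas : ∀ n, Measurable (blockMartingale m c n) := fun n =>
    (measurable_seriesMartingale _ n).mono ((filtration m).le n) le_rfl
  refine measurable_limit_of_tendsto_metrizable_ae (fun n => (hmeas n).aemeasurable) ?_
  filter_upwards [ae_exists_ne_zero hm] with x ⟨s, hs⟩
  refine ⟨blockMartingale m c (s + 1) x, tendsto_const_nhds.congr' ?_⟩
  filter_upwards [eventually_ge_atTop (s + 1)] with n hn
  induction n, hn using Nat.le_induction with
  | base => rfl
  | succ n hn ih =>
    rw [blockMartingale_succ hm c n, dirichletKernel_M_eq_zero hm hn hs, mul_zero, mul_zero,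
      add_zero, ih]

theorem fejer_blockMartingale_second_difference (hm : ∀ k, 2 ≤ m k) {c : ℕ → ℂ} {k q : ℕ}
    (hq : q ≤ M m k) (hgap : ∀ i, M m k - q < i → i < M m k → blockCoeff m c i = 0)
    (x : Group m) :
    ((M m k + q : ℕ) : ℂ) * fejer m (blockMartingale m c) (M m k + q) x -
        2 * (M m k * fejer m (blockMartingale m c) (M m k) x) +
        ((M m k - q : ℕ) : ℂ) * fejer m (blockMartingale m c) (M m k - q) x =
      c k * (rademacher m k x * fejerKernel m q x) := by
  have hdiff := fejer_second_difference hm (a := blockCoeff m c) (n := M m k - q) (q := q)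
    (fun i h0 hi => hgap _ (by omega) (by omega)) x
  rw [Nat.sub_add_cancel hq] at hdiff
  refine hdiff.trans ?_
  simp only [fejerKernel, dirichletKernel, Finset.mul_sum]
  refine Finset.sum_congr rfl fun j hj => Finset.sum_congr rfl fun i hi => ?_
  have hik : i < M m k := by
    rw [Finset.mem_range] at hi hj
    omega
  rw [blockCoeff_M_add hm c hik, psi_M_add hm hik]

theorem norm_mul_norm_fejerKernel_le (hm : ∀ k, 2 ≤ m k) {c : ℕ → ℂ} {k q : ℕ} (hq : q ≤ M m k)
    (hgap : ∀ i, M m k - q < i → i < M m k → blockCoeff m c i = 0) (x : Group m) (w : ℂ) :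
    ‖c k‖ * ‖fejerKernel m q x‖ ≤
      2 * M m k * (‖fejer m (blockMartingale m c) (M m k + q) x - w‖ +
        ‖fejer m (blockMartingale m c) (M m k) x - w‖ +
        ‖fejer m (blockMartingale m c) (M m k - q) x - w‖) := by
  have hdiff := fejer_blockMartingale_second_difference hm hq hgap x
  set A := fejer m (blockMartingale m c) (M m k + q) x - w with hA
  set B := fejer m (blockMartingale m c) (M m k) x - w with hB
  set C := fejer m (blockMartingale m c) (M m k - q) x - w with hC
  have hcentered : c k * (rademacher m k x * fejerKernel m q x) =
      ((M m k + q : ℕ) : ℂ) * A - 2 * (M m k * B) + ((M m k - q : ℕ) : ℂ) * C := by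
    rw [← hdiff, hA, hB, hC, Nat.cast_sub hq, Nat.cast_add]
    ring
  have hadd : (M m k + q : ℕ) ≤ 2 * (M m k : ℝ) := by exact_mod_cast (by omega)
  have hsub : (M m k - q : ℕ) ≤ 2 * (M m k : ℝ) := by exact_mod_cast (by omega)
  calc ‖c k‖ * ‖fejerKernel m q x‖
      = ‖((M m k + q : ℕ) : ℂ) * A - 2 * (M m k * B) + ((M m k - q : ℕ) : ℂ) * C‖ := by
        rw [← hcentered, norm_mul, norm_mul, norm_rademacher, one_mul]
    _ ≤ ‖((M m k + q : ℕ) : ℂ) * A‖ + ‖2 * (M m k * B)‖ + ‖((M m k - q : ℕ) : ℂ) * C‖ :=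
        (norm_add_le _ _).trans (add_le_add_left (norm_sub_le _ _) _)
    _ = (M m k + q : ℕ) * ‖A‖ + 2 * M m k * ‖B‖ + (M m k - q : ℕ) * ‖C‖ := by
        simp only [norm_mul, Complex.norm_natCast, Complex.norm_ofNat, mul_assoc]
    _ ≤ 2 * M m k * ‖A‖ + 2 * M m k * ‖B‖ + 2 * M m k * ‖C‖ := by gcongr
    _ = 2 * M m k * (‖A‖ + ‖B‖ + ‖C‖) := by ring

end BlockMartingale

section HardyNorm

theorem sum_rpow_le_sum_rpow {ι : Type*} (s : Finset ι) (f : ι → ℝ≥0∞) {p : ℝ} (hp : 0 < p)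
    (hp1 : p ≤ 1) : (∑ i ∈ s, f i) ^ p ≤ ∑ i ∈ s, f i ^ p :=
  Finset.le_sum_of_subadditive (fun a : ℝ≥0∞ => a ^ p) (ENNReal.zero_rpow_of_pos hp).le
    (fun a b => ENNReal.rpow_add_le_add_rpow a b hp.le hp1) s f

theorem eLpNorm_ofReal_eq_lintegral {α E : Type*} [MeasurableSpace α] [ENorm E] {μ : Measure α}
    {p : ℝ} (hp : 0 < p) (g : α → E) :
    eLpNorm g (ENNReal.ofReal p) μ = (∫⁻ x, ‖g x‖ₑ ^ p ∂μ) ^ (1 / p) := by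
  rw [eLpNorm_eq_lintegral_rpow_enorm_toReal (ENNReal.ofReal_pos.2 hp).ne' ENNReal.ofReal_ne_top,
    ENNReal.toReal_ofReal hp.le]

variable {m : ℕ → ℕ} [∀ k, NeZero (m k)]

theorem enorm_mul_rademacher_mul_dirichletKernel (hm : ∀ k, 2 ≤ m k) (z : ℂ) (k : ℕ)
    (x : Group m) :
    ‖z * (rademacher m k x * dirichletKernel m (M m k) x)‖ₑ =
      (interval m k 0).indicator (fun _ => ENNReal.ofReal (‖z‖ * M m k)) x := by
  rw [← ofReal_norm, norm_mul, norm_mul, norm_rademacher, one_mul, dirichletKernel_M hm]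
  by_cases hx : x ∈ interval m k 0 <;> simp [hx]

theorem hardyNorm_blockMartingale_le (hm : ∀ k, 2 ≤ m k) {p : ℝ} (hp : 0 < p) (hp1 : p ≤ 1)
    (c : ℕ → ℂ) :
    hardyNorm m p (blockMartingale m c) ≤
      (∑' k, ENNReal.ofReal ((‖c k‖ * M m k) ^ p / M m k)) ^ (1 / p) := by
  set b : ℕ → ℝ≥0∞ := fun k => ENNReal.ofReal (‖c k‖ * M m k) with hb
  have hterm : ∀ k x, (interval m k 0).indicator (fun _ => b k) x ^ p =
      (interval m k 0).indicator (fun _ => b k ^ p) x := fun k x => by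
    by_cases hx : x ∈ interval m k 0 <;> simp [hx, hp]
  have hmax : ∀ x, (⨆ n, ‖blockMartingale m c n x‖ₑ) ^ p ≤
      ∑' k, (interval m k 0).indicator (fun _ => b k ^ p) x := fun x => by
    rw [← ENNReal.le_rpow_inv_iff hp]
    refine iSup_le fun n => (ENNReal.le_rpow_inv_iff hp).2 ?_
    calc ‖blockMartingale m c n x‖ₑ ^ p
        ≤ (∑ k ∈ Finset.range n, (interval m k 0).indicator (fun _ => b k) x) ^ p := by
          rw [blockMartingale_eq_sum hm]
          gcongr
          exact (enorm_sum_le _ _).trans_eq <| Finset.sum_congr rfl fun k _ =>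
            enorm_mul_rademacher_mul_dirichletKernel hm (c k) k x
      _ ≤ ∑ k ∈ Finset.range n, (interval m k 0).indicator (fun _ => b k ^ p) x := by
          simpa only [hterm] using sum_rpow_le_sum_rpow (Finset.range n)
            (fun k => (interval m k 0).indicator (fun _ => b k) x) hp hp1
      _ ≤ _ := ENNReal.sum_le_tsum _
  have hintegral : ∀ k, ∫⁻ x, (interval m k 0).indicator (fun _ => b k ^ p) x ∂(haar m) =
      ENNReal.ofReal ((‖c k‖ * M m k) ^ p / M m k) := fun k => by
    rw [lintegral_indicator_const (measurableSet_interval m k 0), haar_interval, hb,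
      ENNReal.ofReal_rpow_of_nonneg (by positivity) hp.le,
      ENNReal.ofReal_div_of_pos (natCast_M_pos k), ENNReal.ofReal_natCast, div_eq_mul_inv]
  rw [hardyNorm, eLpNorm_ofReal_eq_lintegral hp]
  refine ENNReal.rpow_le_rpow ?_ (by positivity)
  calc ∫⁻ x, ‖⨆ n, ‖blockMartingale m c n x‖ₑ‖ₑ ^ p ∂(haar m)
      ≤ ∫⁻ x, ∑' k, (interval m k 0).indicator (fun _ => b k ^ p) x ∂(haar m) :=
        lintegral_mono hmax
    _ = ∑' k, ∫⁻ x, (interval m k 0).indicator (fun _ => b k ^ p) x ∂(haar m) :=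
        lintegral_tsum fun k =>
          (measurable_const.indicator (measurableSet_interval m k 0)).aemeasurable
    _ = ∑' k, ENNReal.ofReal ((‖c k‖ * M m k) ^ p / M m k) := tsum_congr hintegral

theorem modulus_blockMartingale_le (hm : ∀ k, 2 ≤ m k) {p : ℝ} (hp : 0 < p) (hp1 : p ≤ 1)
    {c : ℕ → ℂ} {N : ℕ} {e : ℕ → ℕ} (he : Function.Injective e)
    (hc : ∀ k, N ≤ k → k ∉ Set.range e → c k = 0) :
    modulus m p (blockMartingale m c) N ≤
      (∑' i, ENNReal.ofReal ((‖c (e i)‖ * M m (e i)) ^ p / M m (e i))) ^ (1 / p) := by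
  set w : ℂ → ℕ → ℝ≥0∞ := fun z k => ENNReal.ofReal ((‖z‖ * M m k) ^ p / M m k) with hw
  have hw0 : ∀ k, w 0 k = 0 := fun k => by simp [hw, hp.ne']
  have hsupp : Function.support (fun k => w ((Set.Ici N).indicator c k) k) ⊆ Set.range e :=
    Function.support_subset_iff'.2 fun k hk => by
      have hzero : (Set.Ici N).indicator c k = 0 :=
        Set.indicator_apply_eq_zero.2 fun hkN => hc k hkN hk
      rw [hzero, hw0]
  simp only [modulus, sub_partialSumFun_blockMartingale hm]
  refine (hardyNorm_blockMartingale_le hm hp hp1 _).trans (ENNReal.rpow_le_rpow ?_ (by positivity))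
  calc ∑' k, w ((Set.Ici N).indicator c k) k
      = ∑' i, w ((Set.Ici N).indicator c (e i)) (e i) := (he.tsum_eq hsupp).symm
    _ ≤ ∑' i, w (c (e i)) (e i) := ENNReal.tsum_le_tsum fun i => by
        rcases Set.indicator_eq_zero_or_self (Set.Ici N) c (e i) with h | h
        · rw [h, hw0]
          exact zero_le
        · rw [h]

theorem memHardy_blockMartingale (hm : ∀ k, 2 ≤ m k) {p : ℝ} {c : ℕ → ℂ}
    (hc : modulus m p (blockMartingale m c) 0 < ∞) : MemHardy m p (blockMartingale m c) := by
  refine ⟨martingale_seriesMartingale hm _, ?_⟩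
  have huniv : Set.Ici (0 : ℕ) = Set.univ := Set.Ici_bot
  simpa only [modulus, sub_partialSumFun_blockMartingale hm, huniv, Set.indicator_univ] using hc

end HardyNorm

section WeakType

theorem not_tendsto_zero_of_le_add {F : ℕ → ℝ≥0∞} {n q : ℕ → ℕ} {ε : ℝ≥0∞} (hε : ε ≠ 0)
    (hnq : Tendsto (fun k => n k - q k) atTop atTop)
    (hF : ∀ k, ε ≤ F (n k + q k) + F (n k) + F (n k - q k)) : ¬ Tendsto F atTop (𝓝 0) := by
  intro hlim
  have hn : Tendsto n atTop atTop := tendsto_atTop_mono (fun k => Nat.sub_le _ _) hnq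
  have hn' : Tendsto (fun k => n k + q k) atTop atTop :=
    tendsto_atTop_mono (fun k => Nat.le_add_right _ _) hn
  have hsum := ((hlim.comp hn').add (hlim.comp hn)).add (hlim.comp hnq)
  rw [add_zero, add_zero] at hsum
  exact hε (nonpos_iff_eq_zero.1 (ge_of_tendsto' hsum hF))

variable {m : ℕ → ℕ} [∀ k, NeZero (m k)]

theorem ofReal_mul_haar_le_weakNorm {p t : ℝ} (ht : 0 < t) (g : Group m → ℂ) :
    ENNReal.ofReal (t ^ p) * haar m {x | t < ‖g x‖} ≤ weakNorm m p g :=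
  le_iSup₂ (f := fun (t : ℝ) (_ : 0 < t) => ENNReal.ofReal (t ^ p) * haar m {x | t < ‖g x‖}) t ht

theorem ofReal_rpow_le_weakNorm_add {p t : ℝ} (ht : 0 < t) {u v w : Group m → ℂ}
    (h : ∀ x, 3 * t < ‖u x‖ + ‖v x‖ + ‖w x‖) :
    ENNReal.ofReal (t ^ p) ≤ weakNorm m p u + weakNorm m p v + weakNorm m p w := by
  have hcover : (Set.univ : Set (Group m)) ⊆
      {x | t < ‖u x‖} ∪ {x | t < ‖v x‖} ∪ {x | t < ‖w x‖} := fun x _ => by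
    by_contra! hx
    simp only [Set.mem_union, Set.mem_ofPred_eq, not_or, not_lt] at hx
    linarith [h x]
  have hhaar : 1 ≤ haar m {x | t < ‖u x‖} + haar m {x | t < ‖v x‖} + haar m {x | t < ‖w x‖} :=
    calc 1 = haar m Set.univ := measure_univ.symm
      _ ≤ haar m ({x | t < ‖u x‖} ∪ {x | t < ‖v x‖} ∪ {x | t < ‖w x‖}) := measure_mono hcover
      _ ≤ _ := (measure_union_le _ _).trans (add_le_add_left (measure_union_le _ _) _)
  calc ENNReal.ofReal (t ^ p)
      ≤ ENNReal.ofReal (t ^ p) *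
          (haar m {x | t < ‖u x‖} + haar m {x | t < ‖v x‖} + haar m {x | t < ‖w x‖}) :=
        le_mul_of_one_le_right' hhaar
    _ ≤ weakNorm m p u + weakNorm m p v + weakNorm m p w := by
        rw [mul_add, mul_add]
        exact add_le_add (add_le_add (ofReal_mul_haar_le_weakNorm ht u)
          (ofReal_mul_haar_le_weakNorm ht v)) (ofReal_mul_haar_le_weakNorm ht w)

theorem fejerKernel_one (x : Group m) : fejerKernel m 1 x = 1 := by
  simp [fejerKernel, dirichletKernel, psi_zero]

theorem not_tendsto_weakNorm_fejer_sub (hm : ∀ k, 2 ≤ m k) (p : ℝ) (g : Group m → ℂ) :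
    ¬ Tendsto (fun n : ℕ => weakNorm m p fun x =>
      fejer m (blockMartingale m fun k => (M m k : ℂ)) n x - g x) atTop (𝓝 0) := by
  have htendsto : Tendsto (fun k => M m k - 1) atTop atTop :=
    tendsto_atTop_mono (fun k => Nat.le_sub_one_of_lt (lt_M_of_le hm le_rfl)) tendsto_id
  refine not_tendsto_zero_of_le_add (n := M m) (q := fun _ => 1)
    (ENNReal.ofReal_pos.2 (by positivity : (0 : ℝ) < (1 / 7) ^ p)).ne' htendsto fun k => ?_
  refine ofReal_rpow_le_weakNorm_add (by norm_num) fun x => ?_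
  have hmain := norm_mul_norm_fejerKernel_le hm (c := fun k => (M m k : ℂ)) (q := 1) (M_pos k)
    (fun i h h' => by omega) x (g x)
  rw [fejerKernel_one, norm_one, mul_one, Complex.norm_natCast] at hmain
  have hM := natCast_M_pos (m := m) k
  by_contra! hcon
  nlinarith

theorem M_add_rpow_le (hm : ∀ k, 2 ≤ m k) {s : ℝ} (hs : s ≤ 0) (N i : ℕ) :
    (M m (N + i) : ℝ) ^ s ≤ (M m N : ℝ) ^ s * (2 ^ s) ^ i := by
  have hle : (2 : ℝ) ^ i * M m N ≤ M m (N + i) := by exact_mod_cast two_pow_mul_M_le hm N i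
  calc (M m (N + i) : ℝ) ^ s
      ≤ ((2 : ℝ) ^ i * M m N) ^ s :=
        Real.rpow_le_rpow_of_nonpos (mul_pos (by positivity) (natCast_M_pos N)) hle hs
    _ = (M m N : ℝ) ^ s * (2 ^ s) ^ i := by
        rw [Real.mul_rpow (by positivity) (by positivity), ← Real.rpow_natCast,
          ← Real.rpow_natCast, ← Real.rpow_mul two_pos.le, ← Real.rpow_mul two_pos.le,
          mul_comm (i : ℝ), mul_comm]

theorem tsum_M_rpow_le (hm : ∀ k, 2 ≤ m k) {s : ℝ} (hs : s < 0) (N : ℕ) :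
    ∑' i, ENNReal.ofReal ((M m (N + i) : ℝ) ^ s) ≤
      ENNReal.ofReal ((1 - 2 ^ s)⁻¹ * (M m N : ℝ) ^ s) := by
  have hr0 : (0 : ℝ) ≤ 2 ^ s := by positivity
  have hr1 : (2 : ℝ) ^ s < 1 := Real.rpow_lt_one_of_one_lt_of_neg one_lt_two hs
  calc ∑' i, ENNReal.ofReal ((M m (N + i) : ℝ) ^ s)
      ≤ ∑' i, ENNReal.ofReal ((M m N : ℝ) ^ s * (2 ^ s) ^ i) :=
        ENNReal.tsum_le_tsum fun i => ENNReal.ofReal_le_ofReal (M_add_rpow_le hm hs.le N i)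
    _ = ENNReal.ofReal (∑' i, (M m N : ℝ) ^ s * (2 ^ s) ^ i) :=
        (ENNReal.ofReal_tsum_of_nonneg (fun i => by positivity)
          ((summable_geometric_of_lt_one hr0 hr1).mul_left _)).symm
    _ = ENNReal.ofReal ((1 - 2 ^ s)⁻¹ * (M m N : ℝ) ^ s) := by
        rw [tsum_mul_left, tsum_geometric_of_lt_one hr0 hr1, mul_comm]

theorem modulus_blockMartingale_M_le (hm : ∀ k, 2 ≤ m k) {p : ℝ} (hp : 0 < p) (hp2 : p < 1 / 2)
    (N : ℕ) :
    modulus m p (blockMartingale m fun k => (M m k : ℂ)) N ≤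
      ENNReal.ofReal
        (((1 - 2 ^ (2 * p - 1))⁻¹) ^ (1 / p) * (1 / (M m N : ℝ) ^ (1 / p - 2))) := by
  have hterm : ∀ k, (‖(M m k : ℂ)‖ * M m k) ^ p / M m k = (M m k : ℝ) ^ (2 * p - 1) := fun k => by
    rw [Complex.norm_natCast, ← sq, Real.rpow_sub_one (natCast_M_pos k).ne',
      Real.rpow_mul (Nat.cast_nonneg _), Real.rpow_two]
  have hK : (0 : ℝ) ≤ (1 - 2 ^ (2 * p - 1))⁻¹ := inv_nonneg.2 <| sub_nonneg.2
    (Real.rpow_lt_one_of_one_lt_of_neg one_lt_two (by linarith)).le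
  have hM : (0 : ℝ) ≤ M m N := Nat.cast_nonneg _
  have hexp : (2 * p - 1) * (1 / p) = -(1 / p - 2) := by
    field_simp
    ring
  refine (modulus_blockMartingale_le hm hp (by linarith) (add_right_injective N)
    fun k hk hk' => absurd ⟨k - N, Nat.add_sub_cancel' hk⟩ hk').trans ?_
  simp only [hterm]
  calc (∑' i, ENNReal.ofReal ((M m (N + i) : ℝ) ^ (2 * p - 1))) ^ (1 / p)
      ≤ ENNReal.ofReal ((1 - 2 ^ (2 * p - 1))⁻¹ * (M m N : ℝ) ^ (2 * p - 1)) ^ (1 / p) :=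
        ENNReal.rpow_le_rpow (tsum_M_rpow_le hm (by linarith) N) (by positivity)
    _ = _ := by
        rw [ENNReal.ofReal_rpow_of_nonneg (mul_nonneg hK (by positivity)) (by positivity),
          Real.mul_rpow hK (by positivity), ← Real.rpow_mul hM, hexp, Real.rpow_neg hM, one_div,
          one_div]

end WeakType

section LeadingSet

/-- The set of points with exactly `t` leading zeros whose coordinate `x_{t+1}` does not vanish
either. The Fejér kernels have a simple form on it. -/
def leadingSet (m : ℕ → ℕ) (t : ℕ) : Set (Group m) :=
  {x | x ∈ interval m t 0 ∧ x t ≠ 0 ∧ x (t + 1) ≠ 0}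

theorem pairwise_disjoint_leadingSet (m : ℕ → ℕ) :
    Pairwise (Function.onFun Disjoint (leadingSet m)) := by
  intro s t hst
  refine Set.disjoint_left.2 fun x hs ht => ?_
  rcases lt_or_gt_of_ne hst with h | h
  · exact hs.2.1 (ht.1 s h)
  · exact ht.2.1 (hs.1 t h)

theorem two_inv_le_card_erase_zero_div {n : ℕ} [NeZero n] (hn : 2 ≤ n) :
    (2 : ℝ≥0∞)⁻¹ ≤ ((Finset.univ.erase (0 : ZMod n)).card : ℝ≥0∞) / n := by
  rw [Finset.card_erase_of_mem (Finset.mem_univ _), Finset.card_univ, ZMod.card,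
    ENNReal.le_div_iff_mul_le (Or.inl (Nat.cast_ne_zero.2 (NeZero.ne n)))
      (Or.inl (ENNReal.natCast_ne_top n)), mul_comm, ← div_eq_mul_inv]
  exact ENNReal.div_le_of_le_mul (by exact_mod_cast (by omega : n ≤ (n - 1) * 2))

variable {m : ℕ → ℕ} [∀ k, NeZero (m k)]

theorem measurableSet_leadingSet (t : ℕ) : MeasurableSet (leadingSet m t) :=
  (filtration m).le (t + 2) _ <| measurableSet_sigmaAlg fun x hx y hy =>
    ⟨fun k hk => (hy k (by omega)).trans (hx.1 k hk), (hy t (by omega)).trans_ne hx.2.1,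
      (hy (t + 1) (by omega)).trans_ne hx.2.2⟩

theorem le_haar_leadingSet (hm : ∀ k, 2 ≤ m k) (t : ℕ) :
    (M m t : ℝ≥0∞)⁻¹ * (2⁻¹ * 2⁻¹) ≤ haar m (leadingSet m t) := by
  have hset : leadingSet m t =
      {x | ∀ k < t + 2, x k ∈ if k < t then {0} else Finset.univ.erase (0 : ZMod (m k))} := by
    ext x
    simp only [leadingSet, interval, Set.mem_ofPred_eq, Nat.forall_lt_succ_right, lt_irrefl,
      not_lt.2 (Nat.le_succ t), if_false, Finset.mem_erase, Finset.mem_univ, and_true, and_assoc]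
    refine and_congr_left fun _ => forall₂_congr fun k hk => ?_
    rw [if_pos hk, Finset.mem_singleton, Pi.zero_apply]
  have hinterval : (M m t : ℝ≥0∞)⁻¹ =
      ∏ k ∈ Finset.range t, (({0} : Finset (ZMod (m k))).card : ℝ≥0∞) / (m k : ℝ≥0∞) := by
    rw [← haar_setOf_forall_mem, ← haar_interval t 0]
    simp only [interval, Finset.mem_singleton, Pi.zero_apply]
  rw [hset, haar_setOf_forall_mem, Finset.prod_range_succ, Finset.prod_range_succ, mul_assoc,
    if_neg (lt_irrefl t), if_neg (not_lt.2 (Nat.le_succ t)), hinterval]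
  refine mul_le_mul' (Finset.prod_congr rfl fun k hk => ?_).le
    (mul_le_mul' (two_inv_le_card_erase_zero_div (hm t))
      (two_inv_le_card_erase_zero_div (hm (t + 1))))
  rw [if_pos (Finset.mem_range.1 hk)]

theorem le_setLIntegral_leadingSet (hm : ∀ k, 2 ≤ m k) {t : ℕ} {u : Group m → ℂ}
    (hu : ∀ x ∈ leadingSet m t, (M m t / 2 : ℝ) ^ 2 ≤ ‖u x‖) :
    ENNReal.ofReal (1 / 8) ≤ ∫⁻ x in leadingSet m t, ‖u x‖ₑ ^ (1 / 2 : ℝ) ∂(haar m) := by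
  have hM := natCast_M_pos (m := m) t
  calc ENNReal.ofReal (1 / 8)
      = ENNReal.ofReal (M m t / 2) * ((M m t : ℝ≥0∞)⁻¹ * (2⁻¹ * 2⁻¹)) := by
        rw [← ENNReal.ofReal_natCast, ← ENNReal.ofReal_inv_of_pos hM, ← ENNReal.ofReal_ofNat 2,
          ← ENNReal.ofReal_inv_of_pos two_pos, ← ENNReal.ofReal_mul (by positivity),
          ← ENNReal.ofReal_mul (by positivity), ← ENNReal.ofReal_mul (by positivity)]
        congr 1
        field_simp
        norm_num
    _ ≤ ENNReal.ofReal (M m t / 2) * haar m (leadingSet m t) :=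
        mul_le_mul_right (le_haar_leadingSet hm t) _
    _ = ∫⁻ _ in leadingSet m t, ENNReal.ofReal (M m t / 2) ∂(haar m) :=
        (setLIntegral_const _ _).symm
    _ ≤ _ := setLIntegral_mono' (measurableSet_leadingSet t) fun x hx => by
        rw [← ofReal_norm, ENNReal.ofReal_rpow_of_nonneg (norm_nonneg _) (by norm_num),
          ← Real.sqrt_eq_rpow]
        exact ENNReal.ofReal_le_ofReal (Real.le_sqrt_of_sq_le (hu x hx))

end LeadingSet

section SparseIndex

/-- The index `M_0 + M_2 + ⋯ + M_{2J-2}`, for which the `L_{1/2}` quasi-norm of the Fejér kernel is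
large. -/
def sparseIndex (m : ℕ → ℕ) (J : ℕ) : ℕ := ∑ j ∈ Finset.range J, M m (2 * j)

variable {m : ℕ → ℕ}

theorem sparseIndex_succ (J : ℕ) : sparseIndex m (J + 1) = M m (2 * J) + sparseIndex m J := by
  rw [sparseIndex, Finset.sum_range_succ, add_comm, sparseIndex]

theorem exists_sparseIndex_eq_mul_M_add {j J : ℕ} (h : j < J) :
    ∃ c, sparseIndex m J = c * M m (2 * j + 2) + sparseIndex m (j + 1) := by
  induction J, h using Nat.le_induction with
  | base => exact ⟨0, by rw [zero_mul, zero_add]⟩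
  | succ J hJ ih =>
    obtain ⟨c, hc⟩ := ih
    obtain ⟨d, hd⟩ := M_dvd (m := m) (show 2 * j + 2 ≤ 2 * J by omega)
    exact ⟨c + d, by rw [sparseIndex_succ, hc, hd]; ring⟩

variable [∀ k, NeZero (m k)]

theorem sparseIndex_le (hm : ∀ k, 2 ≤ m k) (J : ℕ) : sparseIndex m J ≤ M m (2 * J) := by
  induction J with
  | zero => exact Nat.zero_le _
  | succ J ih =>
    calc sparseIndex m (J + 1) ≤ 2 * M m (2 * J) := by rw [sparseIndex_succ]; omega
      _ ≤ M m (2 * J + 1) := two_mul_M_le hm _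
      _ ≤ M m (2 * (J + 1)) := M_mono (by omega)

theorem sparseIndex_succ_le (hm : ∀ k, 2 ≤ m k) (J : ℕ) :
    sparseIndex m (J + 1) ≤ M m (2 * J + 1) := by
  have h := sparseIndex_le hm J
  have h' := two_mul_M_le hm (2 * J)
  rw [sparseIndex_succ]
  omega

theorem sq_le_norm_fejerKernel_sparseIndex (hm : ∀ k, 2 ≤ m k) {j J : ℕ} (h : j < J)
    {x : Group m} (hx : x ∈ leadingSet m (2 * j)) :
    (M m (2 * j) / 2 : ℝ) ^ 2 ≤ ‖fejerKernel m (sparseIndex m J) x‖ := by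
  obtain ⟨c, hc⟩ := exists_sparseIndex_eq_mul_M_add (m := m) h
  have hle : sparseIndex m (j + 1) ≤ M m (2 * j + 2) := sparseIndex_le hm (j + 1)
  calc (M m (2 * j) / 2 : ℝ) ^ 2 ≤ (M m (2 * j) : ℝ) ^ 2 / 2 := by
        nlinarith [sq_nonneg (M m (2 * j) : ℝ)]
    _ ≤ ‖fejerKernel m (M m (2 * j) + sparseIndex m j) x‖ :=
        sq_M_div_two_le_norm_fejerKernel (sparseIndex_le hm j) hx.1
    _ = ‖fejerKernel m (sparseIndex m J) x‖ := by
        rw [hc, fejerKernel_mul_M_add_two_add hm hx.2.1 hx.2.2 c hle, norm_mul, norm_psi, one_mul,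
          sparseIndex_succ]

theorem le_lintegral_fejerKernel_sparseIndex (hm : ∀ k, 2 ≤ m k) (J : ℕ) :
    ENNReal.ofReal (J / 8) ≤
      ∫⁻ x, ‖fejerKernel m (sparseIndex m J) x‖ₑ ^ (1 / 2 : ℝ) ∂(haar m) := by
  have hdisj : (Finset.range J : Set ℕ).PairwiseDisjoint fun j => leadingSet m (2 * j) :=
    fun i _ j _ hij => pairwise_disjoint_leadingSet m (by omega)
  calc ENNReal.ofReal (J / 8)
      = ∑ _j ∈ Finset.range J, ENNReal.ofReal (1 / 8) := by
        rw [Finset.sum_const, Finset.card_range, nsmul_eq_mul, ← ENNReal.ofReal_natCast,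
          ← ENNReal.ofReal_mul (Nat.cast_nonneg _), mul_one_div]
    _ ≤ ∑ j ∈ Finset.range J, ∫⁻ x in leadingSet m (2 * j),
          ‖fejerKernel m (sparseIndex m J) x‖ₑ ^ (1 / 2 : ℝ) ∂(haar m) :=
        Finset.sum_le_sum fun j hj => le_setLIntegral_leadingSet hm fun x hx =>
          sq_le_norm_fejerKernel_sparseIndex hm (Finset.mem_range.1 hj) hx
    _ = ∫⁻ x in ⋃ j ∈ Finset.range J, leadingSet m (2 * j),
          ‖fejerKernel m (sparseIndex m J) x‖ₑ ^ (1 / 2 : ℝ) ∂(haar m) :=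
        (lintegral_biUnion_finset hdisj (fun j _ => measurableSet_leadingSet _) _).symm
    _ ≤ _ := setLIntegral_le_lintegral _ _

end SparseIndex

section SparseMartingale

/-- The coefficients `M_k / k²` for `k = 2, 4, 8, …`, and `0` for the other `k`. Their block
martingale is the counterexample for `p = 1/2`. -/
noncomputable def sparseCoeff (m : ℕ → ℕ) : ℕ → ℂ :=
  (Set.range fun j : ℕ => 2 ^ (j + 1)).indicator fun k => (M m k : ℂ) / (k : ℂ) ^ 2

theorem norm_sparseCoeff_le (m : ℕ → ℕ) (k : ℕ) : ‖sparseCoeff m k‖ ≤ M m k / (k : ℝ) ^ 2 := by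
  refine (norm_indicator_le_norm_self _ _).trans_eq ?_
  rw [norm_div, norm_pow, Complex.norm_natCast, Complex.norm_natCast]

theorem norm_sparseCoeff_two_pow_succ (m : ℕ → ℕ) (j : ℕ) :
    ‖sparseCoeff m (2 ^ (j + 1))‖ = M m (2 ^ (j + 1)) / ((2 : ℝ) ^ (j + 1)) ^ 2 := by
  rw [sparseCoeff, Set.indicator_of_mem (Set.mem_range_self j), norm_div, norm_pow,
    Complex.norm_natCast, Complex.norm_natCast, Nat.cast_pow, Nat.cast_ofNat]

theorem sparseCoeff_two_mul_add_one (m : ℕ → ℕ) (n : ℕ) : sparseCoeff m (2 * n + 1) = 0 := by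
  refine Set.indicator_of_notMem ?_ _
  rintro ⟨j, hj : 2 ^ (j + 1) = 2 * n + 1⟩
  rw [pow_succ] at hj
  omega

theorem ofReal_mul_lintegral_le_eLpNorm_half_add {α : Type*} [MeasurableSpace α] {μ : Measure α}
    {a : ℝ} (ha : 0 ≤ a) {κ u v w : α → ℂ} (hv : Measurable v) (hw : Measurable w)
    (h : ∀ x, a ^ 2 * ‖κ x‖ ≤ ‖u x‖ + ‖v x‖ + ‖w x‖) :
    ENNReal.ofReal a * ∫⁻ x, ‖κ x‖ₑ ^ (1 / 2 : ℝ) ∂μ ≤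
      eLpNorm u (ENNReal.ofReal (1 / 2)) μ ^ (1 / 2 : ℝ) +
        eLpNorm v (ENNReal.ofReal (1 / 2)) μ ^ (1 / 2 : ℝ) +
        eLpNorm w (ENNReal.ofReal (1 / 2)) μ ^ (1 / 2 : ℝ) := by
  have hhalf : (0 : ℝ) < 1 / 2 := by norm_num
  have hnorm : ∀ g : α → ℂ, eLpNorm g (ENNReal.ofReal (1 / 2)) μ ^ (1 / 2 : ℝ) =
      ∫⁻ x, ‖g x‖ₑ ^ (1 / 2 : ℝ) ∂μ := fun g => by
    rw [eLpNorm_ofReal_eq_lintegral hhalf, ← ENNReal.rpow_mul, one_div_mul_cancel hhalf.ne',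
      ENNReal.rpow_one]
  have hpointwise : ∀ x, ENNReal.ofReal a * ‖κ x‖ₑ ^ (1 / 2 : ℝ) ≤
      ‖u x‖ₑ ^ (1 / 2 : ℝ) + ‖v x‖ₑ ^ (1 / 2 : ℝ) + ‖w x‖ₑ ^ (1 / 2 : ℝ) := fun x =>
    calc ENNReal.ofReal a * ‖κ x‖ₑ ^ (1 / 2 : ℝ)
        = ENNReal.ofReal (a ^ 2 * ‖κ x‖) ^ (1 / 2 : ℝ) := by
          rw [ENNReal.ofReal_mul (sq_nonneg a), ENNReal.mul_rpow_of_nonneg _ _ hhalf.le,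
            ENNReal.ofReal_rpow_of_nonneg (sq_nonneg a) hhalf.le, ← Real.sqrt_eq_rpow,
            Real.sqrt_sq ha, ofReal_norm]
      _ ≤ (‖u x‖ₑ + ‖v x‖ₑ + ‖w x‖ₑ) ^ (1 / 2 : ℝ) := by
          refine ENNReal.rpow_le_rpow ((ENNReal.ofReal_le_ofReal (h x)).trans_eq ?_) hhalf.le
          rw [ENNReal.ofReal_add (by positivity) (by positivity),
            ENNReal.ofReal_add (by positivity) (by positivity), ofReal_norm, ofReal_norm,
            ofReal_norm]
      _ ≤ ‖u x‖ₑ ^ (1 / 2 : ℝ) + ‖v x‖ₑ ^ (1 / 2 : ℝ) + ‖w x‖ₑ ^ (1 / 2 : ℝ) :=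
          (ENNReal.rpow_add_le_add_rpow _ _ hhalf.le (by norm_num)).trans <|
            add_le_add_left (ENNReal.rpow_add_le_add_rpow _ _ hhalf.le (by norm_num)) _
  rw [hnorm, hnorm, hnorm, ← lintegral_add_right _ (hv.enorm.pow_const _),
    ← lintegral_add_right _ (hw.enorm.pow_const _),
    ← lintegral_const_mul' _ _ ENNReal.ofReal_ne_top]
  exact lintegral_mono hpointwise

variable {m : ℕ → ℕ} [∀ k, NeZero (m k)]

theorem M_add_sparseIndex_le (hm : ∀ k, 2 ≤ m k) (j : ℕ) :
    M m (2 ^ (j + 1) - 1) + sparseIndex m (2 ^ j) ≤ M m (2 ^ (j + 1)) := by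
  obtain ⟨J, hJ⟩ := Nat.exists_eq_succ_of_ne_zero (pow_ne_zero j two_ne_zero)
  rw [pow_succ, hJ, Nat.succ_eq_add_one, show (J + 1) * 2 = 2 * J + 1 + 1 by ring,
    Nat.add_sub_cancel]
  have h := sparseIndex_succ_le hm J
  have h' := two_mul_M_le hm (2 * J + 1)
  omega

theorem sq_mul_norm_fejerKernel_sparseIndex_le (hm : ∀ k, 2 ≤ m k) (j : ℕ) (x : Group m)
    (w : ℂ) :
    (1 / (2 * 2 ^ (j + 1)) : ℝ) ^ 2 * ‖fejerKernel m (sparseIndex m (2 ^ j)) x‖ ≤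
      ‖fejer m (blockMartingale m (sparseCoeff m)) (M m (2 ^ (j + 1)) + sparseIndex m (2 ^ j)) x
          - w‖ +
        ‖fejer m (blockMartingale m (sparseCoeff m)) (M m (2 ^ (j + 1))) x - w‖ +
        ‖fejer m (blockMartingale m (sparseCoeff m)) (M m (2 ^ (j + 1)) - sparseIndex m (2 ^ j)) x
          - w‖ := by
  have hindex := M_add_sparseIndex_le hm j
  have hpred : 2 ^ (j + 1) - 1 = 2 * (2 ^ j - 1) + 1 := by
    have := Nat.two_pow_pos j
    rw [pow_succ]
    omega
  have hgap : ∀ i, M m (2 ^ (j + 1)) - sparseIndex m (2 ^ j) < i → i < M m (2 ^ (j + 1)) →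
      blockCoeff m (sparseCoeff m) i = 0 := fun i hi hi' => by
    rw [blockCoeff_eq hm _ (k := 2 ^ (j + 1) - 1) (by omega)
      (by rwa [Nat.sub_add_cancel Nat.one_le_two_pow]), hpred, sparseCoeff_two_mul_add_one,
      ite_self]
  have hmain := norm_mul_norm_fejerKernel_le hm (by omega) hgap x w
  rw [norm_sparseCoeff_two_pow_succ] at hmain
  have hM := natCast_M_pos (m := m) (2 ^ (j + 1))
  refine le_of_mul_le_mul_left (le_trans ?_ hmain) (mul_pos two_pos hM)
  calc 2 * (M m (2 ^ (j + 1)) : ℝ) *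
        ((1 / (2 * 2 ^ (j + 1))) ^ 2 * ‖fejerKernel m (sparseIndex m (2 ^ j)) x‖)
      = 1 / 2 * (M m (2 ^ (j + 1)) / ((2 : ℝ) ^ (j + 1)) ^ 2 *
          ‖fejerKernel m (sparseIndex m (2 ^ j)) x‖) := by field_simp
    _ ≤ _ := mul_le_of_le_one_left (by positivity) (by norm_num)

theorem not_tendsto_eLpNorm_fejer_sub (hm : ∀ k, 2 ≤ m k) {g : Group m → ℂ} (hg : Measurable g) :
    ¬ Tendsto (fun n : ℕ => eLpNorm (fun x =>
      fejer m (blockMartingale m (sparseCoeff m)) n x - g x) (ENNReal.ofReal (1 / 2)) (haar m))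
      atTop (𝓝 0) := by
  intro hlim
  have hsqrt := (ENNReal.continuous_rpow_const (y := (1 / 2 : ℝ))).tendsto 0 |>.comp hlim
  rw [ENNReal.zero_rpow_of_pos (by norm_num)] at hsqrt
  have hmeas : ∀ n, Measurable fun x =>
      fejer m (blockMartingale m (sparseCoeff m)) n x - g x := fun n =>
    (measurable_fejer hm _ n).sub hg
  have hindex : ∀ j, j ≤ M m (2 ^ (j + 1)) - sparseIndex m (2 ^ j) := fun j => by
    have h := M_add_sparseIndex_le hm j
    have hpow : j < 2 ^ (j + 1) := j.lt_two_pow_self.trans (Nat.pow_lt_pow_succ one_lt_two)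
    have hlt : 2 ^ (j + 1) - 1 < M m (2 ^ (j + 1) - 1) := lt_M_of_le hm le_rfl
    omega
  refine not_tendsto_zero_of_le_add (ENNReal.ofReal_pos.2 (by norm_num : (0 : ℝ) < 1 / 32)).ne'
    (tendsto_atTop_mono hindex tendsto_id) (fun j => ?_) hsqrt
  calc ENNReal.ofReal (1 / 32)
      = ENNReal.ofReal (1 / (2 * 2 ^ (j + 1))) * ENNReal.ofReal ((2 ^ j : ℕ) / 8) := by
        rw [← ENNReal.ofReal_mul (by positivity)]
        congr 1
        push_cast
        field_simp
        ring
    _ ≤ ENNReal.ofReal (1 / (2 * 2 ^ (j + 1))) *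
          ∫⁻ x, ‖fejerKernel m (sparseIndex m (2 ^ j)) x‖ₑ ^ (1 / 2 : ℝ) ∂(haar m) :=
        mul_le_mul_right (le_lintegral_fejerKernel_sparseIndex hm _) _
    _ ≤ _ := ofReal_mul_lintegral_le_eLpNorm_half_add (by positivity) (hmeas _) (hmeas _)
        fun x => sq_mul_norm_fejerKernel_sparseIndex_le hm j x (g x)

theorem rpow_half_div_le_of_sparseCoeff (k : ℕ) :
    (‖sparseCoeff m k‖ * M m k) ^ (1 / 2 : ℝ) / M m k ≤ 1 / k := by
  have hM := natCast_M_pos (m := m) k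
  rw [div_le_iff₀ hM, ← Real.sqrt_eq_rpow]
  refine Real.sqrt_le_iff.2 ⟨by positivity, ?_⟩
  calc ‖sparseCoeff m k‖ * M m k ≤ M m k / (k : ℝ) ^ 2 * M m k :=
        mul_le_mul_of_nonneg_right (norm_sparseCoeff_le m k) hM.le
    _ = (1 / k * M m k : ℝ) ^ 2 := by ring

theorem modulus_blockMartingale_sparseCoeff_le (hm : ∀ k, 2 ≤ m k) (N : ℕ) :
    modulus m (1 / 2) (blockMartingale m (sparseCoeff m)) N ≤
      ENNReal.ofReal ((2 / 2 ^ Nat.clog 2 N) ^ 2) := by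
  have hinj : Function.Injective fun i => 2 ^ (Nat.clog 2 N + i) := fun i j hij =>
    Nat.add_left_cancel (Nat.pow_right_injective le_rfl hij)
  have hrange : ∀ k, N ≤ k → k ∉ Set.range (fun i => 2 ^ (Nat.clog 2 N + i)) →
      sparseCoeff m k = 0 := fun k hk hk' => by
    refine Set.indicator_of_notMem ?_ _
    rintro ⟨j, rfl⟩
    exact hk' ⟨j + 1 - Nat.clog 2 N, by
      simp only [Nat.add_sub_cancel' (Nat.clog_le_of_le_pow hk)]⟩
  have hterm : ∀ i, ENNReal.ofReal ((‖sparseCoeff m (2 ^ (Nat.clog 2 N + i))‖ *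
      M m (2 ^ (Nat.clog 2 N + i))) ^ (1 / 2 : ℝ) / M m (2 ^ (Nat.clog 2 N + i))) ≤
        ENNReal.ofReal (1 / 2 ^ Nat.clog 2 N * (1 / 2) ^ i) := fun i => by
    refine ENNReal.ofReal_le_ofReal ((rpow_half_div_le_of_sparseCoeff _).trans_eq ?_)
    rw [Nat.cast_pow, Nat.cast_ofNat, pow_add, one_div_pow, one_div_mul_one_div]
  refine (modulus_blockMartingale_le hm one_half_pos (by norm_num) hinj hrange).trans ?_
  calc _ ≤ (∑' i, ENNReal.ofReal (1 / 2 ^ Nat.clog 2 N * (1 / 2) ^ i)) ^ (1 / (1 / 2) : ℝ) :=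
        ENNReal.rpow_le_rpow (ENNReal.tsum_le_tsum hterm) (by norm_num)
    _ = ENNReal.ofReal (2 / 2 ^ Nat.clog 2 N) ^ (2 : ℝ) := by
        rw [← ENNReal.ofReal_tsum_of_nonneg (fun i => by positivity)
          (summable_geometric_two.mul_left _), tsum_mul_left, tsum_geometric_two,
          one_div_mul_eq_div, one_div_one_div]
    _ = ENNReal.ofReal ((2 / 2 ^ Nat.clog 2 N) ^ 2) := by
        rw [ENNReal.ofReal_rpow_of_nonneg (by positivity) two_pos.le, Real.rpow_two]

theorem two_div_two_pow_clog_sq_le {N : ℕ} (hN : 0 < N) :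
    (2 / 2 ^ Nat.clog 2 N : ℝ) ^ 2 ≤ 4 * (1 / (N : ℝ) ^ 2) := by
  have hN' : (0 : ℝ) < N := Nat.cast_pos.2 hN
  have hle : (N : ℝ) ≤ 2 ^ Nat.clog 2 N := by exact_mod_cast Nat.le_pow_clog one_lt_two N
  calc (2 / 2 ^ Nat.clog 2 N : ℝ) ^ 2 ≤ (2 / N : ℝ) ^ 2 :=
        pow_le_pow_left₀ (by positivity) (div_le_div_of_nonneg_left two_pos.le hN' hle) 2
    _ = 4 * (1 / (N : ℝ) ^ 2) := by ring

end SparseMartingale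

end Vilenkin

theorem theorem2_general (m : ℕ → ℕ) [∀ k, NeZero (m k)] (hm : ∀ k, 2 ≤ m k) :
    (∀ p : ℝ, 0 < p → p < 1 / 2 →
      ∃ f : ℕ → Vilenkin.Group m → ℂ, Vilenkin.MemHardy m p f ∧
        (∃ C : ℝ, ∀ᶠ N : ℕ in atTop, Vilenkin.modulus m p f N ≤
          ENNReal.ofReal (C * (1 / (Vilenkin.M m N : ℝ) ^ (1 / p - 2)))) ∧
        ∃ g : Vilenkin.Group m → ℂ, Vilenkin.IsLimitFunction m f g ∧
          ¬ Tendsto (fun n : ℕ => Vilenkin.weakNorm m p fun x => Vilenkin.fejer m f n x - g x)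
              atTop (𝓝 0)) ∧
    (∃ f : ℕ → Vilenkin.Group m → ℂ, Vilenkin.MemHardy m (1 / 2) f ∧
      (∃ C : ℝ, ∀ᶠ N : ℕ in atTop, Vilenkin.modulus m (1 / 2) f N ≤
        ENNReal.ofReal (C * (1 / (N : ℝ) ^ 2))) ∧
      ∃ g : Vilenkin.Group m → ℂ, Vilenkin.IsLimitFunction m f g ∧
        ¬ Tendsto (fun n : ℕ =>
            eLpNorm (fun x => Vilenkin.fejer m f n x - g x) (ENNReal.ofReal (1 / 2))
              (Vilenkin.haar m))
            atTop (𝓝 0)) := by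
  refine ⟨fun p hp hp2 => ?_, ?_⟩
  · have hmodulus := Vilenkin.modulus_blockMartingale_M_le hm hp hp2
    obtain ⟨g, hg⟩ :=
      Vilenkin.exists_isLimitFunction_blockMartingale hm fun k => (Vilenkin.M m k : ℂ)
    exact ⟨_, Vilenkin.memHardy_blockMartingale hm ((hmodulus 0).trans_lt ENNReal.ofReal_lt_top),
      ⟨_, Eventually.of_forall hmodulus⟩, g, hg, Vilenkin.not_tendsto_weakNorm_fejer_sub hm p g⟩
  · have hmodulus := Vilenkin.modulus_blockMartingale_sparseCoeff_le hm
    obtain ⟨g, hg⟩ := Vilenkin.exists_isLimitFunction_blockMartingale hm (Vilenkin.sparseCoeff m)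
    refine ⟨_, Vilenkin.memHardy_blockMartingale hm ((hmodulus 0).trans_lt ENNReal.ofReal_lt_top),
      ⟨4, ?_⟩, g, hg, Vilenkin.not_tendsto_eLpNorm_fejer_sub hm hg.1⟩
    filter_upwards [eventually_gt_atTop 0] with N hN
    exact (hmodulus N).trans (ENNReal.ofReal_le_ofReal (Vilenkin.two_div_two_pow_clog_sq_le hN))

theorem theorem2 (m : ℕ → ℕ) [∀ k, NeZero (m k)] (hm : ∀ k, 2 ≤ m k)
    (hbdd : ∃ B, ∀ k, m k ≤ B) :
    (∀ p : ℝ, 0 < p → p < 1 / 2 →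
      ∃ f : ℕ → Vilenkin.Group m → ℂ, Vilenkin.MemHardy m p f ∧
        (∃ C : ℝ, ∀ᶠ N : ℕ in atTop, Vilenkin.modulus m p f N ≤
          ENNReal.ofReal (C * (1 / (Vilenkin.M m N : ℝ) ^ (1 / p - 2)))) ∧
        ∃ g : Vilenkin.Group m → ℂ, Vilenkin.IsLimitFunction m f g ∧
          ¬ Tendsto (fun n : ℕ => Vilenkin.weakNorm m p fun x => Vilenkin.fejer m f n x - g x)
              atTop (𝓝 0)) ∧
    (∃ f : ℕ → Vilenkin.Group m → ℂ, Vilenkin.MemHardy m (1 / 2) f ∧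
      (∃ C : ℝ, ∀ᶠ N : ℕ in atTop, Vilenkin.modulus m (1 / 2) f N ≤
        ENNReal.ofReal (C * (1 / (N : ℝ) ^ 2))) ∧
      ∃ g : Vilenkin.Group m → ℂ, Vilenkin.IsLimitFunction m f g ∧
        ¬ Tendsto (fun n : ℕ =>
            eLpNorm (fun x => Vilenkin.fejer m f n x - g x) (ENNReal.ofReal (1 / 2))
              (Vilenkin.haar m))
            atTop (𝓝 0)) :=
  theorem2_general m hm
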